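/- Work over $\mathbb{C}$. Let $F=V(f)\subset\mathbb{P}^n=\mathbb{P}(V^*)$ be the hypersurface defined by a nonzero form $f\in S^dV$ of degree $d$, where $V=\langle y_0,\dots,y_n\rangle$, and let $\check{\mathbb{P}}^n=\mathbb{P}(V)$. Let $VSP(F,k)$ be its variety of power sums: the Zariski closure in the Hilbert scheme $\mathrm{Hilb}_k(\check{\mathbb{P}}^n)$ of the set of all $[\Gamma]$, where $\Gamma=\{[l_1],\dots,[l_k]\}$ consists of $k$ distinct points with $f=\lambda_1l_1^d+\dots+\lambda_kl_k^d$ for some $\lambda_i\in\mathbb{C}$. On the open set of all $[Z]\in\mathrm{Hilb}_k(\check{\mathbb{P}}^n)$ that impose independent conditions on forms of degree $d$, the scheme structure of $VSP(F,k)$ is that of the fibre over $f$ of the universal family $\{([Z],f)\}$, i.e. of the zero locus of the section $[Z]\mapsto f|_{I_Z(d)}$ of the vector bundle with fibre $I_Z(d)^*$ (where $f$ is viewed as a linear form on $S^dV^*$). Let $\Gamma$ be a set of $k$ distinct points of $\check{\mathbb{P}}^n$ imposing independent conditions on forms of degree $d$, with $[\Gamma]\in VSP(F,k)$, and assume that $VSP(F,k)$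 has at $[\Gamma]$ the expected dimension $$(kn+k-1)-\Bigl(\tbinom{n+d}{d}-1\Bigr)=k(n+1)-\tbinom{n+d}{d},$$ i.e. that its local ring at $[\Gamma]$ has this Krull dimension. If there is a hypersurface of degree $d$ in $\check{\mathbb{P}}^n$ that is singular at every point of $\Gamma$, then $VSP(F,k)$ is singular at $[\Gamma]$, i.e. its local ring at $[\Gamma]$ is not regular. -/

import Mathlib

open scoped LinearAlgebra.Projectivization
open MvPolynomial AlgebraicGeometry CategoryTheory

noncomputable section

namespace PowerSum

/-! ### Length `k` subschemes of projective space and the Hilbert scheme of points -/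

/-- The degree `e` part of `R[X₀, …, Xₙ] / I`. -/
abbrev GradedPiece {n : ℕ} {R : Type} [CommRing R] (I : Ideal (MvPolynomial (Fin (n + 1)) R))
    (e : ℕ) : Type :=
  homogeneousSubmodule (Fin (n + 1)) R e ⧸
    (I.restrictScalars R).comap (homogeneousSubmodule (Fin (n + 1)) R e).subtype

/-- `g` lies in the saturation of `I` with respect to the irrelevant ideal `(X₀, …, Xₙ)`. -/
def MemSaturation {n : ℕ} {R : Type} [CommRing R] (I : Ideal (MvPolynomial (Fin (n + 1)) R))
    (g : MvPolynomial (Fin (n + 1)) R) : Prop :=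
  ∃ N : ℕ, ∀ j : Fin (n + 1), (X j : MvPolynomial (Fin (n + 1)) R) ^ N * g ∈ I

/-- A family over `Spec R` of length `k` subschemes of `ℙⁿ`, that is, a closed subscheme of
`ℙⁿ_R` that is finite and locally free of rank `k` over `Spec R`, given by its saturated
homogeneous ideal. (Finite local freeness of rank `k` of `Proj (R[X]/I)` over `R` means that
the graded pieces of `R[X]/I` are projective of constant rank `k` in all large degrees.) -/
@[ext]
structure PointFamily (n k : ℕ) (R : Type) [CommRing R] where
  ideal : Ideal (MvPolynomial (Fin (n + 1)) R)
  homogeneous : ∀ g ∈ ideal, ∀ e : ℕ, homogeneousComponent e g ∈ ideal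
  saturated : ∀ g, MemSaturation ideal g → g ∈ ideal
  locallyFree : ∃ e₀ : ℕ, ∀ e ≥ e₀, Module.Projective R (GradedPiece ideal e) ∧
    ∀ q : PrimeSpectrum R, Module.rankAtStalk (GradedPiece ideal e) q = k

/-- The Hilbert scheme `Hilb_k(ℙⁿ)` over `ℂ`: a `ℂ`-scheme together with its functor of points,
which associates with a morphism `Spec R ⟶ Hilb_k(ℙⁿ)` a family over `Spec R` of length `k`
subschemes of `ℙⁿ`, compatibly with base change, such that every family over a `ℂ`-algebra
arises from exactly one morphism over `ℂ`. This determines the scheme up to a unique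
isomorphism. -/
structure HilbertScheme (n k : ℕ) where
  scheme : Scheme.{0}
  toSpec : scheme ⟶ Spec (CommRingCat.of ℂ)
  /-- the pull-back of the universal subscheme along a morphism from an affine scheme -/
  family : ∀ {R : CommRingCat.{0}}, (Spec R ⟶ scheme) → PointFamily n k R
  /-- pulling back along `Spec R' ⟶ Spec R` is base change (extension of the ideal,
  followed by saturation) -/
  baseChange : ∀ {R R' : CommRingCat.{0}} (ψ : R ⟶ R') (φ : Spec R ⟶ scheme)
    (g : MvPolynomial (Fin (n + 1)) R'),
    g ∈ (family (Spec.map ψ ≫ φ)).ideal ↔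
      MemSaturation ((family φ).ideal.map (MvPolynomial.map ψ.hom)) g
  universal : ∀ {R : CommRingCat.{0}} (s : Spec R ⟶ Spec (CommRingCat.of ℂ))
    (Z : PointFamily n k R), ∃! φ : Spec R ⟶ scheme, φ ≫ toSpec = s ∧ family φ = Z

/-! ### Finite sets of points as points of the Hilbert scheme -/

/-- The affine cone over a set of points of `ℙⁿ`, without the origin. -/
def cone {n : ℕ} (Γ : Finset (ℙ ℂ (Fin (n + 1) → ℂ))) : Set (Fin (n + 1) → ℂ) :=
  {v | ∃ hv : v ≠ 0, Projectivization.mk ℂ v hv ∈ Γ}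

/-- The homogeneous ideal of a finite set of points of `ℙⁿ`. -/
def pointsIdeal {n : ℕ} (Γ : Finset (ℙ ℂ (Fin (n + 1) → ℂ))) :
    Ideal (MvPolynomial (Fin (n + 1)) ℂ) :=
  vanishingIdeal ℂ (cone Γ)

theorem rep_mem_cone {n : ℕ} {Γ : Finset (ℙ ℂ (Fin (n + 1) → ℂ))}
    {p : ℙ ℂ (Fin (n + 1) → ℂ)} (hp : p ∈ Γ) : p.rep ∈ cone Γ :=
  ⟨p.rep_nonzero, by rwa [Projectivization.mk_rep]⟩

theorem smul_mem_cone {n : ℕ} {Γ : Finset (ℙ ℂ (Fin (n + 1) → ℂ))} {v : Fin (n + 1) → ℂ}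
    (hv : v ∈ cone Γ) {t : ℂ} (ht : t ≠ 0) : t • v ∈ cone Γ := by
  obtain ⟨h0, h⟩ := hv
  refine ⟨smul_ne_zero ht h0, ?_⟩
  have : Projectivization.mk ℂ (t • v) (smul_ne_zero ht h0) = Projectivization.mk ℂ v h0 :=
    (Projectivization.mk_eq_mk_iff' ℂ _ _ _ _).2 ⟨t, rfl⟩
  rwa [this]

theorem eval_smul_of_isHomogeneous {n e : ℕ} {g : MvPolynomial (Fin (n + 1)) ℂ}
    (hg : g.IsHomogeneous e) (t : ℂ) (v : Fin (n + 1) → ℂ) :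
    eval (t • v) g = t ^ e * eval v g := by
  rw [eval_eq, eval_eq, Finset.mul_sum]
  refine Finset.sum_congr rfl fun a ha => ?_
  have hd : ∑ i ∈ a.support, a i = e := by
    have := hg (mem_support_iff.1 ha)
    rwa [Finsupp.weight_apply, Finsupp.sum, Finset.sum_congr rfl
      (g := fun i => a i) (fun i _ => by simp)] at this
  simp only [Pi.smul_apply, smul_eq_mul, mul_pow, Finset.prod_mul_distrib]
  rw [Finset.prod_pow_eq_pow_sum, hd]
  ring

theorem mem_pointsIdeal_iff_of_isHomogeneous {n e : ℕ} {Γ : Finset (ℙ ℂ (Fin (n + 1) → ℂ))}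
    {g : MvPolynomial (Fin (n + 1)) ℂ} (hg : g.IsHomogeneous e) :
    g ∈ pointsIdeal Γ ↔ ∀ p ∈ Γ, eval p.rep g = 0 := by
  constructor
  · intro h p hp
    exact h _ (rep_mem_cone hp)
  · rintro h v ⟨h0, hv⟩
    obtain ⟨a, ha⟩ := Projectivization.exists_smul_eq_mk_rep ℂ v h0
    have h1 := h _ hv
    rw [← ha] at h1
    change eval ((a : ℂ) • v) g = 0 at h1
    rw [eval_smul_of_isHomogeneous hg] at h1
    exact (mul_eq_zero.1 h1).resolve_left (pow_ne_zero _ a.ne_zero)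

theorem pointsIdeal_isHomogeneous {n : ℕ} (Γ : Finset (ℙ ℂ (Fin (n + 1) → ℂ))) :
    ∀ g ∈ pointsIdeal Γ, ∀ e : ℕ, homogeneousComponent e g ∈ pointsIdeal Γ := by
  intro g hg e v hv
  -- the polynomial `∑ₑ gₑ(v) tᵉ` in `t` vanishes for all `t ≠ 0`
  let P : Polynomial ℂ := ∑ i ∈ Finset.range (g.totalDegree + 1),
    Polynomial.C (eval v (homogeneousComponent i g)) * Polynomial.X ^ i
  have hP : ∀ t : ℂ, t ≠ 0 → P.eval t = 0 := by
    intro t ht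
    have h1 : eval (t • v) g = 0 := hg _ (smul_mem_cone hv ht)
    rw [← sum_homogeneousComponent g, map_sum] at h1
    rw [← h1, Polynomial.eval_finsetSum]
    refine Finset.sum_congr rfl fun i _ => ?_
    rw [eval_smul_of_isHomogeneous (homogeneousComponent_isHomogeneous i g)]
    rw [Polynomial.eval_mul, Polynomial.eval_C, Polynomial.eval_pow, Polynomial.eval_X, mul_comm]
  have hP0 : P = 0 := by
    refine Polynomial.eq_zero_of_infinite_isRoot P (Set.Infinite.mono
      (s := {t : ℂ | t ≠ 0}) (fun t ht => hP t ht) ?_)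
    exact (Set.finite_singleton (0 : ℂ)).infinite_compl
  by_cases he : e ∈ Finset.range (g.totalDegree + 1)
  · have h2 : P.coeff e = eval v (homogeneousComponent e g) := by
      simp only [P, Polynomial.finsetSum_coeff, Polynomial.coeff_C_mul, Polynomial.coeff_X_pow]
      rw [Finset.sum_eq_single e]
      · simp
      · intro b _ hb
        simp [Ne.symm hb]
      · exact fun h => absurd he h
    change eval v (homogeneousComponent e g) = 0
    rw [← h2, hP0, Polynomial.coeff_zero]
  · rw [homogeneousComponent_eq_zero _ _ (by simpa using he)]
    simp

theorem exists_separating {n : ℕ} {p q : ℙ ℂ (Fin (n + 1) → ℂ)} (h : p ≠ q) :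
    ∃ a : MvPolynomial (Fin (n + 1)) ℂ, a.IsHomogeneous 1 ∧ eval q.rep a = 0 ∧
      eval p.rep a ≠ 0 := by
  by_contra hcon
  push Not at hcon
  apply h
  obtain ⟨j, hj⟩ := Function.ne_iff.1 q.rep_nonzero
  rw [← p.mk_rep, ← q.mk_rep]
  refine (Projectivization.mk_eq_mk_iff' ℂ _ _ _ _).2 ⟨p.rep j / q.rep j, ?_⟩
  funext i
  have h1 := hcon (C (q.rep j) * X i - C (q.rep i) * X j)
    (((isHomogeneous_X ℂ i).C_mul _).sub ((isHomogeneous_X ℂ j).C_mul _))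
    (by simp [mul_comm])
  simp only [map_sub, map_mul, eval_C, eval_X] at h1
  simp only [Pi.smul_apply, smul_eq_mul]
  have hj' : q.rep j ≠ 0 := hj
  field_simp
  linear_combination -h1

theorem exists_interpolation {n : ℕ} (Γ : Finset (ℙ ℂ (Fin (n + 1) → ℂ))) {e : ℕ}
    (he : Γ.card ≤ e) (p : ℙ ℂ (Fin (n + 1) → ℂ)) :
    ∃ g : MvPolynomial (Fin (n + 1)) ℂ, g.IsHomogeneous e ∧ eval p.rep g = 1 ∧
      ∀ q ∈ Γ, q ≠ p → eval q.rep g = 0 := by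
  classical
  obtain ⟨j, hj⟩ := Function.ne_iff.1 p.rep_nonzero
  have hj' : p.rep j ≠ 0 := hj
  have hsep : ∀ q : ℙ ℂ (Fin (n + 1) → ℂ), ∃ a : MvPolynomial (Fin (n + 1)) ℂ,
      a.IsHomogeneous 1 ∧ (p ≠ q → eval q.rep a = 0) ∧ eval p.rep a ≠ 0 := by
    intro q
    by_cases hq : p = q
    · exact ⟨X j, isHomogeneous_X ℂ j, fun h => absurd hq h, by simpa using hj'⟩
    · obtain ⟨a, h1, h2, h3⟩ := exists_separating hq
      exact ⟨a, h1, fun _ => h2, h3⟩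
  choose a ha1 ha2 ha3 using hsep
  let g : MvPolynomial (Fin (n + 1)) ℂ := X j ^ (e - Γ.card) * ∏ q ∈ Γ, a q
  have hg : g.IsHomogeneous e := by
    have h1 := ((isHomogeneous_X ℂ j).pow (e - Γ.card)).mul
      (IsHomogeneous.prod Γ a (fun _ => 1) (fun q _ => ha1 q))
    simpa [Nat.sub_add_cancel he] using h1
  have hgp : eval p.rep g ≠ 0 := by
    simp only [g, map_mul, map_pow, eval_X, map_prod]
    exact mul_ne_zero (pow_ne_zero _ hj') (Finset.prod_ne_zero_iff.2 fun q _ => ha3 q)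
  refine ⟨C (eval p.rep g)⁻¹ * g, hg.C_mul _, by simp [hgp], fun q hq hqp => ?_⟩
  have : eval q.rep g = 0 := by
    simp only [g, map_mul, map_prod]
    rw [Finset.prod_eq_zero hq (ha2 q (Ne.symm hqp)), mul_zero]
  simp [this]

theorem finrank_gradedPiece_pointsIdeal {n : ℕ} (Γ : Finset (ℙ ℂ (Fin (n + 1) → ℂ))) {e : ℕ}
    (he : Γ.card ≤ e) : Module.finrank ℂ (GradedPiece (pointsIdeal Γ) e) = Γ.card := by
  classical
  let ev : homogeneousSubmodule (Fin (n + 1)) ℂ e →ₗ[ℂ] (Γ → ℂ) :=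
    LinearMap.pi fun p => (aeval p.1.rep : MvPolynomial (Fin (n + 1)) ℂ →ₐ[ℂ] ℂ).toLinearMap ∘ₗ
      (homogeneousSubmodule (Fin (n + 1)) ℂ e).subtype
  have hev : ∀ g p, ev g p = eval p.1.rep g.1 := fun g p => rfl
  have hker : ((pointsIdeal Γ).restrictScalars ℂ).comap
      (homogeneousSubmodule (Fin (n + 1)) ℂ e).subtype = LinearMap.ker ev := by
    ext g
    rw [LinearMap.mem_ker, Submodule.mem_comap, Submodule.restrictScalars_mem]
    have := mem_pointsIdeal_iff_of_isHomogeneous (Γ := Γ)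
      ((mem_homogeneousSubmodule e g.1).1 g.2)
    refine this.trans ⟨fun h => funext fun p => h p.1 p.2, fun h p hp => congrFun h ⟨p, hp⟩⟩
  have hsurj : Function.Surjective ev := by
    intro c
    choose g h1 h2 h3 using exists_interpolation Γ he
    refine ⟨∑ p : Γ, c p • ⟨g p.1, (mem_homogeneousSubmodule e _).2 (h1 p.1)⟩, ?_⟩
    funext q
    rw [map_sum, Finset.sum_apply, Finset.sum_eq_single q]
    · simp [hev, h2]
    · intro p _ hpq
      have := h3 p.1 q.1 q.2 (fun h => hpq (Subtype.ext h.symm))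
      simp [hev, this]
    · simp
  unfold GradedPiece
  rw [hker, (ev.quotKerEquivOfSurjective hsurj).finrank_eq]
  simp

/-- A set of `k` distinct points of `ℙⁿ`, as a length `k` subscheme. -/
def pointsFamily {n k : ℕ} (Γ : Finset (ℙ ℂ (Fin (n + 1) → ℂ))) (hΓ : Γ.card = k) :
    PointFamily n k (CommRingCat.of ℂ) where
  ideal := pointsIdeal Γ
  homogeneous := pointsIdeal_isHomogeneous Γ
  saturated := by
    rintro g ⟨N, hN⟩ v hv
    obtain ⟨j, hj⟩ := Function.ne_iff.1 hv.1
    have hj' : v j ≠ 0 := hj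
    have h1 := hN j v hv
    change eval v (X j ^ N * g) = 0 at h1
    rw [map_mul, map_pow, eval_X] at h1
    exact (mul_eq_zero.1 h1).resolve_left (pow_ne_zero _ hj')
  locallyFree := by
    refine ⟨Γ.card, fun e he => ⟨?_, fun q => ?_⟩⟩
    · exact inferInstanceAs (Module.Projective ℂ (GradedPiece (pointsIdeal Γ) e))
    · have h1 := finrank_gradedPiece_pointsIdeal Γ he
      have h2 := congrFun (Module.rankAtStalk_eq_finrank_of_free (R := ℂ)
        (M := GradedPiece (pointsIdeal Γ) e)) q
      rw [h1, hΓ] at h2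
      exact h2

namespace HilbertScheme

variable {n k : ℕ} (H : HilbertScheme n k)

/-- The `ℂ`-valued point of the Hilbert scheme that corresponds to `k` distinct points. -/
def pointMap (Γ : Finset (ℙ ℂ (Fin (n + 1) → ℂ))) (hΓ : Γ.card = k) :
    Spec (CommRingCat.of ℂ) ⟶ H.scheme :=
  (H.universal (𝟙 _) (pointsFamily Γ hΓ)).choose

/-- The point `[Γ]` of the Hilbert scheme. -/
def point (Γ : Finset (ℙ ℂ (Fin (n + 1) → ℂ))) (hΓ : Γ.card = k) : H.scheme :=
  H.pointMap Γ hΓ (⊥ : PrimeSpectrum ℂ)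

end HilbertScheme

/-! ### Power sums -/

/-- `Γ = {[l₁], …, [l_k]}` presents `f` as a power sum of degree `d`:
`f = λ₁ l₁ᵈ + ⋯ + λ_k l_kᵈ` for some complex numbers `λᵢ`. A vector `l` stands for the linear
form `∑ⱼ lⱼ yⱼ`. -/
def IsPowerSum {n : ℕ} (d : ℕ) (f : MvPolynomial (Fin (n + 1)) ℂ)
    (Γ : Finset (ℙ ℂ (Fin (n + 1) → ℂ))) : Prop :=
  ∃ c : ℙ ℂ (Fin (n + 1) → ℂ) → ℂ,
    f = ∑ p ∈ Γ, C (c p) * (∑ j, C (p.rep j) * X j) ^ d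

/-- The apolarity pairing of a form `f ∈ SᵈV` over `ℂ` with a form `g ∈ SᵈV^* ⊗ R`, for
`ι : ℂ → R`: it is `g(∂/∂y₀, …, ∂/∂yₙ) f = ∑_α α! f_α g_α`. -/
def apolarPairing {n : ℕ} {R : Type} [CommRing R] (ι : ℂ →+* R)
    (f : MvPolynomial (Fin (n + 1)) ℂ) (g : MvPolynomial (Fin (n + 1)) R) : R :=
  ∑ α ∈ f.support, ι ((∏ j, (α j).factorial : ℕ) * f.coeff α) * g.coeff α

namespace HilbertScheme

variable {n k : ℕ} (H : HilbertScheme n k)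

/-- The variety of power sums `VSP(F, k)` of `F = V(f)` as a closed subset of the Hilbert scheme:
the Zariski closure of the set of all `[Γ]`, with `Γ` a set of `k` points presenting `f` as a
power sum. -/
def vsp (d : ℕ) (f : MvPolynomial (Fin (n + 1)) ℂ) : Set H.scheme :=
  closure {x | ∃ (Γ : Finset (ℙ ℂ (Fin (n + 1) → ℂ))) (hΓ : Γ.card = k),
    IsPowerSum d f Γ ∧ x = H.point Γ hΓ}

/-- The structure map `ℂ → 𝒪_{Hilb, x}`. -/
def stalkMap (x : H.scheme) : ℂ →+* H.scheme.presheaf.stalk x :=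
  (Spec.preimage (H.scheme.fromSpecStalk x ≫ H.toSpec)).hom

/-- The ideal of `𝒪_{Hilb, x}` that expresses that the subscheme `Z` is apolar to `f` in
degree `d`: it is generated by the values of the linear form `f` on `SᵈV^*` at all elements of
`I_Z(d)`, where `Z` is the restriction of the universal subscheme to `Spec 𝒪_{Hilb, x}`. -/
def apolarIdeal (d : ℕ) (f : MvPolynomial (Fin (n + 1)) ℂ) (x : H.scheme) :
    Ideal (H.scheme.presheaf.stalk x) :=
  Ideal.span {a | ∃ g ∈ (H.family (H.scheme.fromSpecStalk x)).ideal,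
    g.IsHomogeneous d ∧ a = apolarPairing (H.stalkMap x) f g}

/-- The local ring of `VSP(F, k)` at a point `x = [Z]` of the Hilbert scheme such that `Z` imposes
independent conditions on forms of degree `d`. On the open set `U` of these `[Z]`,
the scheme `VSP(F, k)` is the fibre over `f` of the universal family
`{([Z], f) | f ∈ ⟨ρ_d(Z)⟩} ⊆ U × ℙ(SᵈV)`, that is, the zero locus of the
section `f|_{I_Z(d)}` of the vector bundle with fibre `I_Z(d)^*` over `U`. -/
abbrev VSPLocalRing (d : ℕ) (f : MvPolynomial (Fin (n + 1)) ℂ) (x : H.scheme) : Type :=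
  H.scheme.presheaf.stalk x ⧸ H.apolarIdeal d f x

/-- `VSP(F, k)` has at `x` the dimension `k(n+1) - binom(n+d, d)` that is expected from the
projection of the universal family to `ℙ(SᵈV)`: the family has dimension `kn + k - 1`, and the
projective space has dimension `binom(n+d, d) - 1`. -/
def HasExpectedDimensionAt (d : ℕ) (f : MvPolynomial (Fin (n + 1)) ℂ) (x : H.scheme) : Prop :=
  ringKrullDim (H.VSPLocalRing d f x) + ((n + d).choose d : ℕ) = (k * (n + 1) : ℕ)

/-- `VSP(F, k)` is singular at its point `x`: its local ring there is not regular. -/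
def IsSingularAt (d : ℕ) (f : MvPolynomial (Fin (n + 1)) ℂ) (x : H.scheme) : Prop :=
  ¬ IsRegularLocalRing (H.VSPLocalRing d f x)

end HilbertScheme

/-- The points of `Γ` impose independent conditions on forms of degree `d`: the values of
such a form at the points of `Γ` can be prescribed arbitrarily. -/
def ImposesIndependentConditions {n : ℕ} (d : ℕ) (Γ : Finset (ℙ ℂ (Fin (n + 1) → ℂ))) : Prop :=
  ∀ c : ℙ ℂ (Fin (n + 1) → ℂ) → ℂ, ∃ g : MvPolynomial (Fin (n + 1)) ℂ,
    g.IsHomogeneous d ∧ ∀ p ∈ Γ, eval p.rep g = c p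

/-- The hypersurface `g = 0` is singular along `Γ`. -/
def IsSingularAlong {n : ℕ} (g : MvPolynomial (Fin (n + 1)) ℂ)
    (Γ : Finset (ℙ ℂ (Fin (n + 1) → ℂ))) : Prop :=
  ∀ p ∈ Γ, eval p.rep g = 0 ∧ ∀ j, eval p.rep (pderiv j g) = 0

end PowerSum

end

noncomputable section

namespace PowerSum

/-! ### Homogeneous polynomials over a local ring with residue field `ℂ` -/

/-! The proof compares Krull dimension with embedding dimension. Near `[Γ]` the scheme is the zero
locus of `f|_{I_Z(d)}`. If `[Γ]` lies on it, `f` acts on forms of degree `d` as `∑ c_p ev_p`. A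
first order motion `w` of the points then stays in the zero locus when `∑ c_p ∂_{w_p} h(p) = 0` for
every `h ∈ I_Γ(d)`. With `N = binom(n+d, d)`, the space of motions has dimension `k(n+1)`.
Normalizing representatives costs `k` conditions, and `I_Γ(d)` costs at most `N - k`. A form `g`
singular along `Γ` gives the zero condition, so at least `k(n+1) - N + 1` dimensions survive
(`le_finrank_apolarDeformations`). This exceeds the expected dimension by one.

It remains to see that these motions bound the embedding dimension from below
(`finrank_apolarDeformations_le`). Let `W` be their space. The tautological motion is a family of
sections over `ℂ ⊕ W^*`. The universal property turns it into a homomorphism from the local ring of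
the Hilbert scheme (`exists_stalk_hom`), which kills the apolar ideal. No nonzero `w` is invisible
to it, so generators of the maximal ideal have images spanning `W^*`.

The bridge between equations of the universal family and forms through `Γ` is
`PointFamily.exists_lift`: where `Γ` imposes independent conditions, every form through `Γ` lifts to
the ideal of the family. It follows from Nakayama's lemma and saturation. -/

theorem homogeneousComponent_map {σ R S : Type*} [CommSemiring R] [CommSemiring S] (ρ : R →+* S)
    (e : ℕ) (g : MvPolynomial σ R) :
    homogeneousComponent e (map ρ g) = map ρ (homogeneousComponent e g) := by
  ext α
  simp only [coeff_homogeneousComponent, coeff_map]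
  split_ifs <;> simp

theorem exists_isHomogeneous_map_eq {σ R S : Type*} [CommSemiring R] [CommSemiring S]
    {ρ : R →+* S} (hρ : Function.Surjective ρ) {e : ℕ} {h : MvPolynomial σ S}
    (hh : h.IsHomogeneous e) : ∃ g : MvPolynomial σ R, g.IsHomogeneous e ∧ map ρ g = h := by
  obtain ⟨g, rfl⟩ := map_surjective ρ hρ h
  refine ⟨homogeneousComponent e g, homogeneousComponent_isHomogeneous e g, ?_⟩
  rw [← homogeneousComponent_map, homogeneousComponent_of_mem hh, if_pos rfl]

theorem ker_eq_maximalIdeal {A K : Type*} [CommRing A] [IsLocalRing A] [Field K] {ρ : A →+* K}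
    (hρ : Function.Surjective ρ) : RingHom.ker ρ = IsLocalRing.maximalIdeal A :=
  IsLocalRing.eq_maximalIdeal (RingHom.ker_isMaximal_of_surjective ρ hρ)

/-- Expanding in monomials puts every coefficient in the kernel. This is the form in which
congruences modulo the maximal ideal enter Nakayama's lemma. -/
theorem mem_ker_smul_top_of_map_eq_zero {σ R S : Type*} [CommRing R] [CommRing S]
    (ρ : R →+* S) {e : ℕ} (s : homogeneousSubmodule σ R e) (hs : map ρ s.1 = 0) :
    s ∈ RingHom.ker ρ • (⊤ : Submodule R (homogeneousSubmodule σ R e)) := by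
  have hdeg : ∀ α ∈ s.1.support, (monomial α (1 : R)) ∈ homogeneousSubmodule σ R e := by
    intro α hα
    refine isHomogeneous_monomial _ ?_
    have := s.2 (mem_support_iff.1 hα)
    rwa [Finsupp.degree_eq_weight_one]
  have h1 : s = ∑ α ∈ s.1.support.attach, coeff α.1 s.1 •
      (⟨monomial α.1 1, hdeg α.1 α.2⟩ : homogeneousSubmodule σ R e) := by
    apply Subtype.ext
    rw [AddSubmonoidClass.coe_finsetSum]
    simp only [SetLike.mk_smul_mk, smul_monomial, smul_eq_mul, mul_one]
    rw [Finset.sum_attach s.1.support (fun α => monomial α (coeff α s.1))]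
    exact (support_sum_monomial_coeff s.1).symm
  rw [h1]
  refine Submodule.sum_mem _ fun α _ => Submodule.smul_mem_smul ?_ trivial
  rw [RingHom.mem_ker, ← coeff_map, hs, coeff_zero]

variable {n k : ℕ}

/-! ### Lifting forms through `Γ` to a family over a local ring -/

section Local

variable {A : Type} [CommRing A] [IsLocalRing A] {ρ : A →+* ℂ}
  {Γ : Finset (ℙ ℂ (Fin (n + 1) → ℂ))} {Z : PointFamily n k A}

instance finite_gradedPiece {R : Type} [CommRing R] (I : Ideal (MvPolynomial (Fin (n + 1)) R))
    (e : ℕ) : Module.Finite R (GradedPiece I e) := by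
  have : Module.Finite R (homogeneousSubmodule (Fin (n + 1)) R e) :=
    Module.Finite.iff_fg.2 (homogeneousSubmodule_fg _ _ e)
  infer_instance

/-- Over a local ring finite projective modules are free, and the rank can be read off at the closed
point. -/
theorem PointFamily.exists_free (Z : PointFamily n k A) : ∃ e₀ : ℕ, ∀ e ≥ e₀,
    Module.Free A (GradedPiece Z.ideal e) ∧ Module.finrank A (GradedPiece Z.ideal e) = k := by
  obtain ⟨e₀, h⟩ := Z.locallyFree
  refine ⟨e₀, fun e he => ?_⟩
  obtain ⟨h1, h2⟩ := h e he
  have hfree : Module.Free A (GradedPiece Z.ideal e) := Module.free_of_flat_of_isLocalRing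
  refine ⟨hfree, ?_⟩
  have h3 := h2 (IsLocalRing.closedPoint A)
  rwa [Module.rankAtStalk_eq_finrank_of_free] at h3

/-- In large degrees, the reduction of a family is determined by its saturation. -/
theorem PointFamily.exists_lift_of_large_degree (hρ : Function.Surjective ρ) (hΓ : Γ.card = k)
    (hle : ∀ g ∈ Z.ideal, map ρ g ∈ pointsIdeal Γ) :
    ∃ e₁ : ℕ, ∀ e ≥ e₁, ∀ h ∈ pointsIdeal Γ, h.IsHomogeneous e →
      ∃ g ∈ Z.ideal, g.IsHomogeneous e ∧ map ρ g = h := by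
  classical
  obtain ⟨e₀, hZ⟩ := Z.exists_free
  refine ⟨max e₀ k, fun e he h hh hhe => ?_⟩
  obtain ⟨hfree, hrank⟩ := hZ e (le_of_max_le_left he)
  let b : Module.Basis (Fin k) A (GradedPiece Z.ideal e) :=
    (Module.finBasis A (GradedPiece Z.ideal e)).reindex (finCongr hrank)
  choose s hs using fun i => Submodule.mkQ_surjective _ (b i)
  -- every form is a combination of the `s i` modulo the ideal
  have hspan : ∀ t : MvPolynomial (Fin (n + 1)) A, t.IsHomogeneous e →
      ∃ a : Fin k → A, t - ∑ i, C (a i) * (s i).1 ∈ Z.ideal := by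
    intro t ht
    let t' : homogeneousSubmodule (Fin (n + 1)) A e := ⟨t, ht⟩
    refine ⟨b.repr (Submodule.mkQ _ t'), ?_⟩
    have h1 : Submodule.mkQ ((Z.ideal.restrictScalars A).comap
        (homogeneousSubmodule (Fin (n + 1)) A e).subtype)
        (t' - ∑ i, b.repr (Submodule.mkQ _ t') i • s i) = 0 := by
      rw [map_sub, map_sum]
      simp only [map_smul, hs]
      rw [b.sum_repr, sub_self]
    rw [Submodule.mkQ_apply, Submodule.Quotient.mk_eq_zero, Submodule.mem_comap,
      Submodule.restrictScalars_mem] at h1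
    simpa [t', smul_eq_C_mul] using h1
  -- The same spanning statement after reduction to `ℂ`, with the error term still coming from the
  -- ideal of the family.
  have hred : ∀ h : MvPolynomial (Fin (n + 1)) ℂ, h.IsHomogeneous e →
      ∃ a : Fin k → A, ∃ g ∈ Z.ideal, g.IsHomogeneous e ∧
        h = map ρ g + ∑ i, C (ρ (a i)) * map ρ (s i).1 := by
    intro h hh
    obtain ⟨t, ht, rfl⟩ := exists_isHomogeneous_map_eq hρ hh
    obtain ⟨a, ha⟩ := hspan t ht
    refine ⟨a, _, ha, ht.sub (IsHomogeneous.sum _ _ _ fun i _ => ?_), ?_⟩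
    · exact IsHomogeneous.C_mul (s i).2 _
    · simp [map_sub, map_sum]
  -- so the values of the `s i` at the points of `Γ` span `ℂ ^ Γ`
  let v : Fin k → (Γ → ℂ) := fun i p => eval p.1.rep (map ρ (s i).1)
  have hv : ⊤ ≤ Submodule.span ℂ (Set.range v) := by
    intro c _
    choose q h1 h2 h3 using exists_interpolation Γ (hΓ.trans_le (le_of_max_le_right he))
    obtain ⟨a, g, hg, -, ha⟩ := hred (∑ p : Γ, C (c p) * q p.1)
      (IsHomogeneous.sum _ _ _ fun p _ => (h1 p.1).C_mul _)
    have : c = ∑ i, ρ (a i) • v i := by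
      funext p
      have h4 := congrArg (eval p.1.rep) ha
      rw [map_sum, Finset.sum_eq_single p] at h4
      · have h5 : eval p.1.rep (map ρ g) = 0 := hle g hg _ (rep_mem_cone p.2)
        rw [map_add, h5, map_sum] at h4
        simpa [h2, v] using h4
      · intro r _ hrp
        simp [h3 r.1 p.1 p.2 (fun h => hrp (Subtype.ext h.symm))]
      · simp
    rw [this]
    exact Submodule.sum_mem _ fun i _ =>
      Submodule.smul_mem _ _ (Submodule.subset_span (Set.mem_range_self i))
  -- There are `k` vectors spanning a space of dimension `|Γ| = k`. This equality of ranks upgrades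
  -- the inclusion `hle` to an equality in degree `e`: a form vanishing on `Γ` has no component
  -- along the `s i`.
  have hli : LinearIndependent ℂ v :=
    linearIndependent_of_top_le_span_of_card_eq_finrank hv (by simp [hΓ])
  obtain ⟨a, g, hg, hge, ha⟩ := hred h hhe
  have h0 : ∑ i, ρ (a i) • v i = 0 := by
    funext p
    have h4 := congrArg (eval p.1.rep) ha
    have h5 : eval p.1.rep (map ρ g) = 0 := hle g hg _ (rep_mem_cone p.2)
    have h6 : eval p.1.rep h = 0 := hh _ (rep_mem_cone p.2)
    rw [map_add, h5, h6, map_sum] at h4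
    simpa [v] using h4.symm
  have h7 := Fintype.linearIndependent_iff.1 hli _ h0
  refine ⟨g, hg, hge, ?_⟩
  rw [ha]
  simp [h7]

theorem exists_isHomogeneous_eval_eq_one (Γ : Finset (ℙ ℂ (Fin (n + 1) → ℂ))) {c : ℕ}
    (hc : Γ.card ≤ c) : ∃ q : MvPolynomial (Fin (n + 1)) ℂ, q.IsHomogeneous c ∧
      ∀ p ∈ Γ, eval p.rep q = 1 := by
  choose g h1 h2 h3 using exists_interpolation Γ hc
  refine ⟨∑ p ∈ Γ, g p, IsHomogeneous.sum _ _ _ fun p _ => h1 p, fun p hp => ?_⟩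
  rw [map_sum, Finset.sum_eq_single p (fun r _ hr => h3 r p hp (Ne.symm hr))
    (fun h => absurd hp h), h2]

theorem imposesIndependentConditions_of_card_le {Γ : Finset (ℙ ℂ (Fin (n + 1) → ℂ))} {e : ℕ}
    (he : Γ.card ≤ e) : ImposesIndependentConditions e Γ := by
  intro c
  choose g h1 h2 h3 using exists_interpolation Γ he
  refine ⟨∑ p ∈ Γ, C (c p) * g p, IsHomogeneous.sum _ _ _ fun p _ => (h1 p).C_mul _,
    fun p hp => ?_⟩
  rw [map_sum, Finset.sum_eq_single p (fun r _ hr => by simp [h3 r p hp (Ne.symm hr)])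
    (fun h => absurd hp h)]
  simp [h2]

/-- Nakayama's lemma: modulo the maximal ideal, a form of degree `d` with the same values as `s` on
`Γ` works, because `q` is `1` there and the difference, vanishing on `Γ`, lifts to the ideal. -/
theorem PointFamily.exists_sub_mul_mem (hρ : Function.Surjective ρ) {d c : ℕ}
    (hind : ImposesIndependentConditions d Γ)
    (hlift : ∀ h ∈ pointsIdeal Γ, h.IsHomogeneous (d + c) →
      ∃ g ∈ Z.ideal, g.IsHomogeneous (d + c) ∧ map ρ g = h)
    {q : MvPolynomial (Fin (n + 1)) A} (hq : q.IsHomogeneous c)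
    (hq1 : ∀ p ∈ Γ, eval p.rep (map ρ q) = 1) {s : MvPolynomial (Fin (n + 1)) A}
    (hs : s.IsHomogeneous (d + c)) : ∃ h, h.IsHomogeneous d ∧ s - h * q ∈ Z.ideal := by
  let S := homogeneousSubmodule (Fin (n + 1)) A (d + c)
  let L : Submodule A S :=
    { carrier := {s | ∃ h, h.IsHomogeneous d ∧ s.1 - h * q ∈ Z.ideal}
      add_mem' := by
        rintro s t ⟨h, h1, h2⟩ ⟨h', h1', h2'⟩
        refine ⟨h + h', h1.add h1', ?_⟩
        have := Z.ideal.add_mem h2 h2'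
        convert this using 1
        rw [Submodule.coe_add]
        ring
      zero_mem' := ⟨0, isHomogeneous_zero _ _ _, by simp⟩
      smul_mem' := by
        rintro a s ⟨h, h1, h2⟩
        refine ⟨C a * h, h1.C_mul a, ?_⟩
        have := Z.ideal.mul_mem_left (C a) h2
        convert this using 1
        rw [Submodule.coe_smul, smul_eq_C_mul]
        ring }
  have hL : (⊤ : Submodule A S) ≤ L := by
    refine Submodule.le_of_le_smul_of_le_jacobson_bot (I := RingHom.ker ρ)
      (Module.Finite.iff_fg.2 (homogeneousSubmodule_fg _ _ _)).fg_top ?_ ?_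
    · rw [ker_eq_maximalIdeal hρ]
      exact IsLocalRing.maximalIdeal_le_jacobson _
    · intro s _
      obtain ⟨h, h1, h2⟩ := hind fun p => eval p.rep (map ρ s.1)
      obtain ⟨h', h1', rfl⟩ := exists_isHomogeneous_map_eq hρ h1
      have hhom : (s.1 - h' * q).IsHomogeneous (d + c) := IsHomogeneous.sub s.2 (h1'.mul hq)
      obtain ⟨g, hg, hge, hgs⟩ := hlift (map ρ (s.1 - h' * q))
        ((mem_pointsIdeal_iff_of_isHomogeneous (hhom.map ρ)).2 fun p hp => by
          simp [map_sub, map_mul, h2 p hp, hq1 p hp]) (hhom.map ρ)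
      let t : S := ⟨h' * q + g, (h1'.mul hq).add hge⟩
      have ht : t ∈ L := ⟨h', h1', by simpa [t] using hg⟩
      have hst : s - t ∈ RingHom.ker ρ • (⊤ : Submodule A S) := by
        apply mem_ker_smul_top_of_map_eq_zero
        have : (s - t).1 = s.1 - h' * q - g := by
          simp only [t, AddSubgroupClass.coe_sub]
          ring
        rw [this, map_sub, hgs, sub_self]
      exact Submodule.mem_sup.2 ⟨t, ht, s - t, hst, by abel⟩
  exact hL (x := ⟨s, hs⟩) trivial

/-- Multiplication by `q` is a surjection between free modules of the same finite rank, hence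
injective. -/
theorem PointFamily.mem_of_mul_mem (Z : PointFamily n k A) {e c : ℕ}
    (h1 : Module.Free A (GradedPiece Z.ideal e) ∧ Module.finrank A (GradedPiece Z.ideal e) = k)
    (h2 : Module.Free A (GradedPiece Z.ideal (e + c)) ∧
      Module.finrank A (GradedPiece Z.ideal (e + c)) = k)
    {q : MvPolynomial (Fin (n + 1)) A} (hq : q.IsHomogeneous c)
    (hsurj : ∀ s : MvPolynomial (Fin (n + 1)) A, s.IsHomogeneous (e + c) →
      ∃ h, h.IsHomogeneous e ∧ s - h * q ∈ Z.ideal)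
    {h : MvPolynomial (Fin (n + 1)) A} (hh : h.IsHomogeneous e) (hhq : h * q ∈ Z.ideal) :
    h ∈ Z.ideal := by
  obtain ⟨hf1, hr1⟩ := h1
  obtain ⟨hf2, hr2⟩ := h2
  let m : homogeneousSubmodule (Fin (n + 1)) A e →ₗ[A]
      homogeneousSubmodule (Fin (n + 1)) A (e + c) :=
    (LinearMap.mulRight A q).restrict fun s hs => IsHomogeneous.mul hs hq
  let μ : GradedPiece Z.ideal e →ₗ[A] GradedPiece Z.ideal (e + c) :=
    Submodule.mapQ _ _ m fun s hs => Z.ideal.mul_mem_right q hs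
  have hμ : Function.Surjective μ := by
    intro y
    obtain ⟨s, rfl⟩ := Submodule.mkQ_surjective _ y
    obtain ⟨t, ht, hts⟩ := hsurj s.1 s.2
    refine ⟨Submodule.mkQ _ ⟨t, ht⟩, ?_⟩
    simp only [μ, Submodule.mkQ_apply]
    refine ((Submodule.Quotient.eq _).2 ?_).symm
    exact hts
  let E := LinearEquiv.ofFinrankEq (R := A) (GradedPiece Z.ideal (e + c)) (GradedPiece Z.ideal e)
    (hr2.trans hr1.symm)
  have hinj : Function.Injective (E.toLinearMap ∘ₗ μ) :=
    OrzechProperty.injective_of_surjective_endomorphism _ (E.surjective.comp hμ)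
  have h0 : μ (Submodule.mkQ _ ⟨h, hh⟩) = 0 := by
    have : μ (Submodule.mkQ _ ⟨h, hh⟩) = Submodule.mkQ _ (m ⟨h, hh⟩) := rfl
    rw [this, Submodule.mkQ_apply, Submodule.Quotient.mk_eq_zero]
    exact hhq
  have h3 : Submodule.mkQ ((Z.ideal.restrictScalars A).comap
      (homogeneousSubmodule (Fin (n + 1)) A e).subtype) ⟨h, hh⟩ = 0 :=
    hinj (by rw [LinearMap.comp_apply, h0, map_zero, map_zero])
  rw [Submodule.mkQ_apply, Submodule.Quotient.mk_eq_zero] at h3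
  exact h3

/-- A form through `Γ` extends to a form through the members of the family `Z`, if `Γ` imposes
independent conditions on forms of that degree. -/
theorem PointFamily.exists_lift (hρ : Function.Surjective ρ) (hΓ : Γ.card = k)
    (hle : ∀ g ∈ Z.ideal, map ρ g ∈ pointsIdeal Γ) {d : ℕ}
    (hind : ImposesIndependentConditions d Γ) {h : MvPolynomial (Fin (n + 1)) ℂ}
    (hh : h ∈ pointsIdeal Γ) (hhd : h.IsHomogeneous d) :
    ∃ g ∈ Z.ideal, g.IsHomogeneous d ∧ map ρ g = h := by
  obtain ⟨e₀, hfree⟩ := Z.exists_free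
  obtain ⟨e₁, hlift⟩ := PointFamily.exists_lift_of_large_degree hρ hΓ hle
  let c := max e₀ (max e₁ k)
  have hc0 : e₀ ≤ c := le_max_left _ _
  have hc1 : e₁ ≤ c := (le_max_left _ _).trans (le_max_right _ _)
  have hck : k ≤ c := (le_max_right _ _).trans (le_max_right _ _)
  obtain ⟨q', hq', hq1⟩ := exists_isHomogeneous_eval_eq_one Γ (hΓ.trans_le hck)
  obtain ⟨q, hq, rfl⟩ := exists_isHomogeneous_map_eq hρ hq'
  -- multiplication by `q` is injective modulo the ideal
  have hinj : ∀ s : MvPolynomial (Fin (n + 1)) A, s.IsHomogeneous d → s * q ∈ Z.ideal →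
      s ∈ Z.ideal := by
    intro s hs hsq
    -- Degree `d` itself may be too small for freeness. Multiplying by `X j ^ c` moves to a large
    -- degree, and saturation brings the conclusion back.
    refine Z.saturated _ ⟨c, fun j => ?_⟩
    have hX : ((X j : MvPolynomial (Fin (n + 1)) A) ^ c).IsHomogeneous c := by
      simpa using (isHomogeneous_X A j).pow c
    refine Z.mem_of_mul_mem (hfree (c + d) (by omega)) (hfree (c + d + c) (by omega)) hq
      (fun t ht => PointFamily.exists_sub_mul_mem hρ
        (imposesIndependentConditions_of_card_le (by omega))
        (hlift _ (by omega)) hq hq1 ht) (hX.mul hs) ?_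
    rw [mul_assoc]
    exact Z.ideal.mul_mem_left _ hsq
  obtain ⟨h', hh', rfl⟩ := exists_isHomogeneous_map_eq hρ hhd
  obtain ⟨g₁, hg₁, hg₁d, hg₁h⟩ := hlift (d + c) (by omega) (map ρ (h' * q))
    (by rw [map_mul]; exact (pointsIdeal Γ).mul_mem_right _ hh) ((hh'.mul hq).map ρ)
  have hmem : (⟨h' * q - g₁, (hh'.mul hq).sub hg₁d⟩ :
      homogeneousSubmodule (Fin (n + 1)) A (d + c)) ∈ RingHom.ker ρ • (⊤ : Submodule A _) := by
    apply mem_ker_smul_top_of_map_eq_zero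
    rw [map_sub, hg₁h, sub_self]
  -- The error `h' * q - g₁` can be divided by `q` modulo the ideal with a quotient that reduces to
  -- zero. Subtracting this quotient from `h'` corrects the lift without changing its reduction.
  have key : ∀ s ∈ RingHom.ker ρ •
      (⊤ : Submodule A (homogeneousSubmodule (Fin (n + 1)) A (d + c))),
      ∃ t : MvPolynomial (Fin (n + 1)) A, t.IsHomogeneous d ∧ map ρ t = 0 ∧
        s.1 - t * q ∈ Z.ideal := by
    intro s hs
    induction hs using Submodule.smul_induction_on' with
    | smul a ha s _ =>
      obtain ⟨t, ht, hts⟩ := PointFamily.exists_sub_mul_mem hρ hind (hlift _ (by omega)) hq hq1 s.2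
      refine ⟨C a * t, ht.C_mul a, ?_, ?_⟩
      · rw [map_mul, map_C, (RingHom.mem_ker).1 ha, C_0, zero_mul]
      · have := Z.ideal.mul_mem_left (C a) hts
        convert this using 1
        rw [Submodule.coe_smul, smul_eq_C_mul]
        ring
    | add s _ s' _ h1 h2 =>
      obtain ⟨t, ht, ht0, hts⟩ := h1
      obtain ⟨t', ht', ht0', hts'⟩ := h2
      refine ⟨t + t', ht.add ht', by rw [map_add, ht0, ht0', add_zero], ?_⟩
      have := Z.ideal.add_mem hts hts'
      convert this using 1
      rw [Submodule.coe_add]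
      ring
  obtain ⟨t, ht, ht0, hts⟩ := key _ hmem
  refine ⟨h' - t, hinj _ (hh'.sub ht) ?_, hh'.sub ht, by rw [map_sub, ht0, sub_zero]⟩
  have := Z.ideal.add_mem hts hg₁
  convert this using 1
  ring

end Local

/-- The special fibre of the family is exactly `Γ`: the ideals agree in large degrees, and
saturation sees nothing else. -/
theorem PointFamily.memSaturation_map_iff {A : Type} [CommRing A] [IsLocalRing A] {ρ : A →+* ℂ}
    {Γ : Finset (ℙ ℂ (Fin (n + 1) → ℂ))} {Z : PointFamily n k A} (hρ : Function.Surjective ρ)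
    (hΓ : Γ.card = k) (hle : ∀ g ∈ Z.ideal, map ρ g ∈ pointsIdeal Γ)
    (g : MvPolynomial (Fin (n + 1)) ℂ) :
    MemSaturation (Z.ideal.map (map ρ)) g ↔ g ∈ pointsIdeal Γ := by
  constructor
  · rintro ⟨N, hN⟩
    refine (pointsFamily Γ hΓ).saturated g ⟨N, fun j => ?_⟩
    exact Ideal.map_le_iff_le_comap.2 hle (hN j)
  · intro hg
    obtain ⟨N, hN⟩ := PointFamily.exists_lift_of_large_degree hρ hΓ hle
    refine ⟨N, fun j => ?_⟩
    rw [← sum_homogeneousComponent g, Finset.mul_sum]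
    refine Ideal.sum_mem _ fun e _ => ?_
    have hX : ((X j : MvPolynomial (Fin (n + 1)) ℂ) ^ N).IsHomogeneous N := by
      simpa using (isHomogeneous_X ℂ j).pow N
    obtain ⟨h, hh, -, hhe⟩ := hN (N + e) (by omega) _
      ((pointsIdeal Γ).mul_mem_left (X j ^ N) (pointsIdeal_isHomogeneous Γ g hg e))
      (hX.mul (homogeneousComponent_isHomogeneous e g))
    rw [← hhe]
    exact Ideal.mem_map_of_mem _ hh

theorem ringHom_eval {R S σ : Type*} [CommSemiring R] [CommSemiring S] (ρ : R →+* S) (P : σ → R)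
    (g : MvPolynomial σ R) : ρ (eval P g) = eval (fun j => ρ (P j)) (map ρ g) := by
  rw [← eval₂_id, hom_eval₂, MvPolynomial.eval_map]
  rfl

/-! ### The family of subschemes given by `k` sections over a local ring -/

/-- Restriction of polynomials to the line spanned by `P`. -/
def restrictLine {R : Type} [CommRing R] (P : Fin (n + 1) → R) :
    MvPolynomial (Fin (n + 1)) R →+* Polynomial R :=
  eval₂Hom Polynomial.C fun j => Polynomial.C (P j) * Polynomial.X

/-- The variable of the line records the degree, so vanishing on the whole line means that each
homogeneous component vanishes at `P`. -/
theorem coeff_restrictLine {R : Type} [CommRing R] (P : Fin (n + 1) → R)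
    (g : MvPolynomial (Fin (n + 1)) R) (e : ℕ) :
    (restrictLine P g).coeff e = eval P (homogeneousComponent e g) := by
  induction g using MvPolynomial.induction_on' with
  | add p q hp hq => rw [map_add, Polynomial.coeff_add, hp, hq, map_add, map_add]
  | monomial α a =>
    have h1 : restrictLine P (monomial α a) =
        Polynomial.C (eval P (monomial α a)) * Polynomial.X ^ α.degree := by
      simp only [restrictLine, coe_eval₂Hom, eval₂_monomial, eval_monomial, map_mul, map_finsuppProd,
        map_pow, mul_pow, Finsupp.prod_mul, mul_assoc]
      congr 2
      rw [Finsupp.prod, Finset.prod_pow_eq_pow_sum]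
      rfl
    rw [h1, homogeneousComponent_of_mem
      ((mem_homogeneousSubmodule _ _).2 (isHomogeneous_monomial a rfl)), Polynomial.coeff_C_mul,
      Polynomial.coeff_X_pow]
    split_ifs <;> simp

/-- The homogeneous ideal of a set of sections. -/
def sectionsIdeal {R : Type} [CommRing R] {ι : Type} (P : ι → Fin (n + 1) → R) :
    Ideal (MvPolynomial (Fin (n + 1)) R) :=
  ⨅ i, RingHom.ker (restrictLine (P i))

theorem mem_sectionsIdeal_iff {R : Type} [CommRing R] {ι : Type} {P : ι → Fin (n + 1) → R}
    {g : MvPolynomial (Fin (n + 1)) R} :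
    g ∈ sectionsIdeal P ↔ ∀ i e, eval (P i) (homogeneousComponent e g) = 0 := by
  simp only [sectionsIdeal, Ideal.mem_iInf, RingHom.mem_ker, Polynomial.ext_iff, coeff_restrictLine,
    Polynomial.coeff_zero]

theorem mem_sectionsIdeal_iff_of_isHomogeneous {R : Type} [CommRing R] {ι : Type}
    {P : ι → Fin (n + 1) → R} {g : MvPolynomial (Fin (n + 1)) R} {e : ℕ} (hg : g.IsHomogeneous e) :
    g ∈ sectionsIdeal P ↔ ∀ i, eval (P i) g = 0 := by
  rw [mem_sectionsIdeal_iff]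
  refine forall_congr' fun i => ⟨fun h => ?_, fun h e' => ?_⟩
  · simpa [homogeneousComponent_of_mem hg] using h e
  · rw [homogeneousComponent_of_mem hg]
    split_ifs
    · exact h
    · exact map_zero _

section Sections

variable {R : Type} [CommRing R] {ρ : R →+* ℂ} {Γ : Finset (ℙ ℂ (Fin (n + 1) → ℂ))}
  {P : Γ → Fin (n + 1) → R}

theorem map_mem_pointsIdeal_of_mem_sectionsIdeal (hP : ∀ p j, ρ (P p j) = p.1.rep j)
    {g : MvPolynomial (Fin (n + 1)) R} (hg : g ∈ sectionsIdeal P) :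
    map ρ g ∈ pointsIdeal Γ := by
  rw [← sum_homogeneousComponent (map ρ g)]
  refine Ideal.sum_mem _ fun e _ => (mem_pointsIdeal_iff_of_isHomogeneous
    (homogeneousComponent_isHomogeneous e _)).2 fun p hp => ?_
  have h1 := congrArg ρ (mem_sectionsIdeal_iff.1 hg ⟨p, hp⟩ e)
  rw [map_zero, ringHom_eval, ← homogeneousComponent_map] at h1
  simpa only [hP] using h1

variable [IsLocalRing R]

/-- Some coordinate of each section is a unit, since its reduction is nonzero. The corresponding
variable restricts to a unit times `X`, which is a nonzerodivisor. -/
theorem sectionsIdeal_saturated (hρ : Function.Surjective ρ) (hP : ∀ p j, ρ (P p j) = p.1.rep j)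
    (g : MvPolynomial (Fin (n + 1)) R) (hg : MemSaturation (sectionsIdeal P) g) :
    g ∈ sectionsIdeal P := by
  obtain ⟨N, hN⟩ := hg
  refine (Ideal.mem_iInf).2 fun p => ?_
  obtain ⟨j, hj⟩ := Function.ne_iff.1 p.1.rep_nonzero
  have hu : IsUnit (P p j) := by
    rw [← IsLocalRing.notMem_maximalIdeal, ← ker_eq_maximalIdeal hρ, RingHom.mem_ker, hP]
    exact hj
  have h1 : restrictLine (P p) (X j ^ N * g) = 0 := (Ideal.mem_iInf).1 (hN j) p
  rw [map_mul, map_pow] at h1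
  have h2 : restrictLine (P p) (X j) = Polynomial.C (P p j) * Polynomial.X := by
    simp [restrictLine]
  rw [h2, mul_pow, mul_assoc, ← Polynomial.C_pow] at h1
  have h3 : Polynomial.X ^ N * restrictLine (P p) g = 0 :=
    ((hu.pow N).map Polynomial.C).mul_left_cancel (by rw [h1, mul_zero])
  rw [RingHom.mem_ker]
  ext i
  have h4 := congrArg (fun Q => Polynomial.coeff Q (i + N)) h3
  simpa [Polynomial.coeff_X_pow_mul] using h4

/-- Interpolation at the points of `Γ` over `ℂ`, lifted to the sections by Nakayama's lemma. -/
theorem exists_isHomogeneous_eval_eq (hρ : Function.Surjective ρ)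
    (hP : ∀ p j, ρ (P p j) = p.1.rep j) {e : ℕ} (he : Γ.card ≤ e) (c : Γ → R) :
    ∃ g : MvPolynomial (Fin (n + 1)) R, g.IsHomogeneous e ∧ ∀ p, eval (P p) g = c p := by
  classical
  let ev : homogeneousSubmodule (Fin (n + 1)) R e →ₗ[R] (Γ → R) :=
    LinearMap.pi fun p => (aeval (P p) : MvPolynomial (Fin (n + 1)) R →ₐ[R] R).toLinearMap ∘ₗ
      (homogeneousSubmodule (Fin (n + 1)) R e).subtype
  have hev : ∀ g p, ev g p = eval (P p) g.1 := fun g p => rfl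
  have htop : (⊤ : Submodule R (Γ → R)) ≤ LinearMap.range ev := by
    refine Submodule.le_of_le_smul_of_le_jacobson_bot (I := RingHom.ker ρ)
      Module.Finite.fg_top ?_ ?_
    · rw [ker_eq_maximalIdeal hρ]
      exact IsLocalRing.maximalIdeal_le_jacobson _
    · intro c _
      obtain ⟨h, h1, h2⟩ := imposesIndependentConditions_of_card_le he
        fun p => if hp : p ∈ Γ then ρ (c ⟨p, hp⟩) else 0
      obtain ⟨g, hg, rfl⟩ := exists_isHomogeneous_map_eq hρ h1
      refine Submodule.mem_sup.2 ⟨ev ⟨g, hg⟩, LinearMap.mem_range_self _ _, c - ev ⟨g, hg⟩, ?_,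
        by abel⟩
      rw [pi_eq_sum_univ (c - ev ⟨g, hg⟩)]
      refine Submodule.sum_mem _ fun p _ => Submodule.smul_mem_smul ?_ trivial
      have h3 := h2 p.1 p.2
      rw [dif_pos p.2] at h3
      rw [RingHom.mem_ker, Pi.sub_apply, map_sub, hev, ringHom_eval]
      simp only [hP]
      rw [h3, sub_self]
  obtain ⟨g, hg⟩ := htop (x := c) trivial
  exact ⟨g.1, g.2, fun p => by rw [← hev, hg]⟩

/-- The family of subschemes that consists of `k` sections over a local ring. -/
def sectionsFamily (hρ : Function.Surjective ρ) (hP : ∀ p j, ρ (P p j) = p.1.rep j)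
    (hΓ : Γ.card = k) : PointFamily n k R where
  ideal := sectionsIdeal P
  homogeneous := by
    intro g hg e
    rw [mem_sectionsIdeal_iff_of_isHomogeneous (homogeneousComponent_isHomogeneous e g)]
    exact fun i => mem_sectionsIdeal_iff.1 hg i e
  saturated := sectionsIdeal_saturated hρ hP
  locallyFree := by
    refine ⟨Γ.card, fun e he => ?_⟩
    let ev : homogeneousSubmodule (Fin (n + 1)) R e →ₗ[R] (Γ → R) :=
      LinearMap.pi fun p => (aeval (P p) : MvPolynomial (Fin (n + 1)) R →ₐ[R] R).toLinearMap ∘ₗ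
        (homogeneousSubmodule (Fin (n + 1)) R e).subtype
    have hker : ((sectionsIdeal P).restrictScalars R).comap
        (homogeneousSubmodule (Fin (n + 1)) R e).subtype = LinearMap.ker ev := by
      ext g
      rw [LinearMap.mem_ker, Submodule.mem_comap, Submodule.restrictScalars_mem]
      refine (mem_sectionsIdeal_iff_of_isHomogeneous
        ((mem_homogeneousSubmodule e g.1).1 g.2)).trans
        ⟨fun h => funext h, fun h p => congrFun h p⟩
    have hsurj : Function.Surjective ev := by
      intro c
      obtain ⟨g, hg, hgc⟩ := exists_isHomogeneous_eval_eq hρ hP he c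
      exact ⟨⟨g, hg⟩, funext hgc⟩
    let E : GradedPiece (sectionsIdeal P) e ≃ₗ[R] (Γ → R) :=
      (Submodule.quotEquivOfEq _ _ hker).trans (ev.quotKerEquivOfSurjective hsurj)
    have hfree : Module.Free R (GradedPiece (sectionsIdeal P) e) := Module.Free.of_equiv E.symm
    refine ⟨inferInstance, fun q => ?_⟩
    have h1 := congrFun (Module.rankAtStalk_eq_of_equiv E) q
    rw [h1, Module.rankAtStalk_eq_finrank_of_free]
    simp [hΓ]

end Sections

/-! ### First order deformations -/

/-- Application of an additive map to the coefficients of a polynomial. -/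
def coeffMap {R S σ : Type*} [CommSemiring R] [CommSemiring S] (D : R →+ S)
    (g : MvPolynomial σ R) : MvPolynomial σ S :=
  ∑ α ∈ g.support, monomial α (D (coeff α g))

section Derivation

variable {R S σ : Type*} [CommSemiring R] [CommSemiring S] (D : R →+ S)

@[simp]
theorem coeff_coeffMap (g : MvPolynomial σ R) (α : σ →₀ ℕ) :
    coeff α (coeffMap D g) = D (coeff α g) := by
  classical
  rw [coeffMap, coeff_sum]
  simp only [coeff_monomial, Finset.sum_ite_eq', mem_support_iff]
  split_ifs with h
  · rfl
  · rw [not_not.1 h, map_zero]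

theorem isHomogeneous_coeffMap {g : MvPolynomial σ R} {e : ℕ} (hg : g.IsHomogeneous e) :
    (coeffMap D g).IsHomogeneous e := by
  intro α hα
  refine hg fun h => hα ?_
  rw [coeff_coeffMap, h, map_zero]

theorem coeffMap_add (g h : MvPolynomial σ R) :
    coeffMap D (g + h) = coeffMap D g + coeffMap D h := by
  ext α
  simp

theorem coeffMap_mul_X (g : MvPolynomial σ R) (j : σ) :
    coeffMap D (g * X j) = coeffMap D g * X j := by
  classical
  ext α
  simp only [coeff_coeffMap, coeff_mul_X']
  split_ifs <;> simp

theorem coeffMap_C (a : R) : coeffMap D (C a : MvPolynomial σ R) = C (D a) := by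
  classical
  ext α
  simp only [coeff_coeffMap, coeff_C]
  split_ifs <;> simp

/-- The first order Taylor expansion of a polynomial function. -/
theorem derivation_eval [Fintype σ] (ρ : R →+* S) (hD : ∀ a b, D (a * b) = ρ a * D b + ρ b * D a)
    (P : σ → R) (g : MvPolynomial σ R) :
    D (eval P g) = eval (fun j => ρ (P j)) (coeffMap D g) +
      ∑ j, eval (fun j => ρ (P j)) (pderiv j (map ρ g)) * D (P j) := by
  classical
  induction g using MvPolynomial.induction_on with
  | C a => simp [coeffMap_C]
  | add p q hp hq =>
    simp only [map_add, coeffMap_add, hp, hq, add_mul, Finset.sum_add_distrib]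
    ring
  | mul_X p i hp =>
    have h1 := ringHom_eval ρ P p
    simp only [map_mul, eval_X, coeffMap_mul_X, hD, hp, map_X, Derivation.leibniz, pderiv_X,
      smul_eq_mul, map_add, add_mul, Finset.sum_add_distrib, h1]
    have h2 : ∑ j, eval (fun j => ρ (P j)) (map ρ p) *
        eval (fun j => ρ (P j)) (Pi.single (M := fun _ => MvPolynomial σ S) j 1 i) * D (P j) =
        eval (fun j => ρ (P j)) (map ρ p) * D (P i) := by
      rw [Finset.sum_eq_single i]
      · simp
      · intro j _ hj
        simp [Pi.single_eq_of_ne (Ne.symm hj)]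
      · simp
    have h3 : ∑ j, ρ (P i) * eval (fun j => ρ (P j)) (pderiv j (map ρ p)) * D (P j) =
        ρ (P i) * ∑ j, eval (fun j => ρ (P j)) (pderiv j (map ρ p)) * D (P j) := by
      rw [Finset.mul_sum]
      exact Finset.sum_congr rfl fun j _ => mul_assoc _ _ _
    rw [mul_add, h2, h3]
    ring

end Derivation

/-! ### The apolarity pairing under base change and derivations -/

section Apolar

variable {R S : Type} [CommRing R] [CommRing S] (ι : ℂ →+* R)
  (f : MvPolynomial (Fin (n + 1)) ℂ)

theorem apolarPairing_add (g h : MvPolynomial (Fin (n + 1)) R) :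
    apolarPairing ι f (g + h) = apolarPairing ι f g + apolarPairing ι f h := by
  simp [apolarPairing, mul_add, Finset.sum_add_distrib]

theorem apolarPairing_C_mul (a : R) (g : MvPolynomial (Fin (n + 1)) R) :
    apolarPairing ι f (C a * g) = a * apolarPairing ι f g := by
  simp only [apolarPairing, coeff_C_mul, Finset.mul_sum]
  exact Finset.sum_congr rfl fun α _ => by ring

/-- The apolarity pairing with `f` as a linear form. -/
def apolarForm : MvPolynomial (Fin (n + 1)) ℂ →ₗ[ℂ] ℂ where
  toFun := apolarPairing (RingHom.id ℂ) f
  map_add' := apolarPairing_add _ f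
  map_smul' a g := by rw [smul_eq_C_mul, apolarPairing_C_mul, RingHom.id_apply, smul_eq_mul]

theorem map_apolarPairing (ψ : R →+* S) (g : MvPolynomial (Fin (n + 1)) R) :
    ψ (apolarPairing ι f g) = apolarPairing (ψ.comp ι) f (map ψ g) := by
  simp [apolarPairing, map_sum, coeff_map]

/-- The coefficients of `f` enter as constants from `ℂ`, over which `D` is linear; only those of `g`
are differentiated. -/
theorem derivation_apolarPairing (D : R →+ ℂ) (hD : ∀ a b, D (ι a * b) = a * D b)
    (g : MvPolynomial (Fin (n + 1)) R) :
    D (apolarPairing ι f g) = apolarForm f (coeffMap D g) := by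
  simp only [apolarForm, LinearMap.coe_mk, AddHom.coe_mk, apolarPairing, map_sum, hD,
    coeff_coeffMap, RingHom.id_apply]

/-- A form that is apolar to all forms through `Γ` acts on forms of degree `d` by evaluation at the
points of `Γ`. -/
theorem exists_apolarForm_eq {d : ℕ} {Γ : Finset (ℙ ℂ (Fin (n + 1) → ℂ))}
    (hind : ImposesIndependentConditions d Γ)
    (hf : ∀ h ∈ pointsIdeal Γ, h.IsHomogeneous d → apolarForm f h = 0) :
    ∃ c : Γ → ℂ, ∀ h : MvPolynomial (Fin (n + 1)) ℂ, h.IsHomogeneous d →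
      apolarForm f h = ∑ p, c p * eval p.1.rep h := by
  classical
  choose q h1 h2 using fun p : Γ => hind (Pi.single p.1 1)
  refine ⟨fun p => apolarForm f (q p), fun h hh => ?_⟩
  have h3 : h - ∑ p : Γ, eval p.1.rep h • q p ∈ pointsIdeal Γ ∧
      (h - ∑ p : Γ, eval p.1.rep h • q p).IsHomogeneous d := by
    have hhom : (h - ∑ p : Γ, eval p.1.rep h • q p).IsHomogeneous d :=
      hh.sub (IsHomogeneous.sum _ _ _ fun p _ => by
        rw [smul_eq_C_mul]; exact (h1 p).C_mul _)
    refine ⟨(mem_pointsIdeal_iff_of_isHomogeneous hhom).2 fun r hr => ?_, hhom⟩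
    rw [map_sub, map_sum, Finset.sum_eq_single (⟨r, hr⟩ : Γ)]
    · simp [smul_eq_C_mul, h2 _ r hr]
    · intro p _ hp
      have : r ≠ p.1 := fun h => hp (Subtype.ext h.symm)
      simp [smul_eq_C_mul, h2 _ r hr, this]
    · simp
  have h4 := hf _ h3.1 h3.2
  rw [map_sub, sub_eq_zero, map_sum] at h4
  rw [h4]
  refine Finset.sum_congr rfl fun p _ => ?_
  rw [map_smul, smul_eq_mul, mul_comm]

end Apolar

/-! ### Homomorphisms from the local rings of the Hilbert scheme -/

theorem exists_stalk_hom_of_closedPoint {X : Scheme.{0}} {R : CommRingCat.{0}} [IsLocalRing R]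
    (φ : Spec R ⟶ X) {x : X} (hx : φ (IsLocalRing.closedPoint R) = x) :
    ∃ ψ : X.presheaf.stalk x ⟶ R, Spec.map ψ ≫ X.fromSpecStalk x = φ := by
  subst hx
  exact ⟨Scheme.stalkClosedPointTo φ, Scheme.Spec_stalkClosedPointTo_fromSpecStalk φ⟩

namespace HilbertScheme

variable (H : HilbertScheme n k)

theorem pointMap_spec (Γ : Finset (ℙ ℂ (Fin (n + 1) → ℂ))) (hΓ : Γ.card = k) :
    H.pointMap Γ hΓ ≫ H.toSpec = 𝟙 _ ∧ H.family (H.pointMap Γ hΓ) = pointsFamily Γ hΓ :=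
  (H.universal (𝟙 _) (pointsFamily Γ hΓ)).choose_spec.1

theorem comp_stalkMap {R : CommRingCat.{0}} (x : H.scheme) (ι : ℂ →+* R)
    (ψ : H.scheme.presheaf.stalk x ⟶ R)
    (h : (Spec.map ψ ≫ H.scheme.fromSpecStalk x) ≫ H.toSpec = Spec.map (CommRingCat.ofHom ι)) :
    ψ.hom.comp (H.stalkMap x) = ι := by
  have h1 : Spec.preimage (H.scheme.fromSpecStalk x ≫ H.toSpec) ≫ ψ = CommRingCat.ofHom ι := by
    apply Spec.map_injective
    rw [Spec.map_comp, Spec.map_preimage, ← h, Category.assoc]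
  exact congrArg CommRingCat.Hom.hom h1

/-- Sections over a local `ℂ`-algebra that pass through the points of `Γ` correspond to a
homomorphism from the local ring of the Hilbert scheme at `[Γ]`. -/
theorem exists_stalk_hom {Γ : Finset (ℙ ℂ (Fin (n + 1) → ℂ))} (hΓ : Γ.card = k) {R : Type}
    [CommRing R] [IsLocalRing R] {ι : ℂ →+* R} {ρ : R →+* ℂ} (hρι : ρ.comp ι = RingHom.id ℂ)
    {P : Γ → Fin (n + 1) → R} (hP : ∀ p j, ρ (P p j) = p.1.rep j) :
    ∃ ψ : H.scheme.presheaf.stalk (H.point Γ hΓ) →+* R,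
      ψ.comp (H.stalkMap (H.point Γ hΓ)) = ι ∧
      ∀ g ∈ (H.family (H.scheme.fromSpecStalk (H.point Γ hΓ))).ideal,
        map ψ g ∈ sectionsIdeal P := by
  have hρ : Function.Surjective ρ := fun z => ⟨ι z, RingHom.congr_fun hρι z⟩
  obtain ⟨φ, ⟨hφ1, hφ2⟩, -⟩ := H.universal (R := CommRingCat.of R)
    (Spec.map (CommRingCat.ofHom ι)) (sectionsFamily hρ hP hΓ)
  -- Both morphisms classify `Γ` over `ℂ`, so the uniqueness in the universal property identifies
  -- them. Hence `φ` sends the closed point to `[Γ]` and factors through the stalk.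
  have hpt : Spec.map (CommRingCat.ofHom ρ) ≫ φ = H.pointMap Γ hΓ := by
    refine (H.universal (𝟙 _) (pointsFamily Γ hΓ)).unique ⟨?_, ?_⟩ (H.pointMap_spec Γ hΓ)
    · rw [Category.assoc, hφ1, ← Spec.map_comp, ← CommRingCat.ofHom_comp, hρι]
      exact Spec.map_id _
    · apply PointFamily.ext
      ext g
      rw [H.baseChange, hφ2]
      exact PointFamily.memSaturation_map_iff (Z := sectionsFamily hρ hP hΓ) hρ hΓ
        (fun g hg => map_mem_pointsIdeal_of_mem_sectionsIdeal hP hg) g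
  have hx : φ (IsLocalRing.closedPoint R) = H.point Γ hΓ := by
    rw [point, ← hpt]
    refine (congrArg φ ?_).trans
      (Scheme.Hom.comp_apply (Spec.map (CommRingCat.ofHom ρ)) φ _).symm
    apply PrimeSpectrum.ext
    exact (ker_eq_maximalIdeal hρ).symm
  obtain ⟨ψ, hψ⟩ := exists_stalk_hom_of_closedPoint (R := CommRingCat.of R) φ hx
  refine ⟨ψ.hom, H.comp_stalkMap _ ι ψ (by rw [hψ, hφ1]), fun g hg => ?_⟩
  have h1 : map ψ.hom g ∈ (H.family (Spec.map ψ ≫ H.scheme.fromSpecStalk _)).ideal :=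
    (H.baseChange ψ _ _).2 ⟨0, fun j => by
      rw [pow_zero, one_mul]
      exact Ideal.mem_map_of_mem _ hg⟩
  rw [hψ, hφ2] at h1
  exact h1

end HilbertScheme

/-! ### The space of apolar first order deformations -/

section Tangent

variable {Γ : Finset (ℙ ℂ (Fin (n + 1) → ℂ))}

/-- The derivative at `p` of a polynomial `h` in the direction `v`. -/
def directionalDeriv (p : Fin (n + 1) → ℂ) :
    MvPolynomial (Fin (n + 1)) ℂ →ₗ[ℂ] (Fin (n + 1) → ℂ) →ₗ[ℂ] ℂ :=
  LinearMap.mk₂ ℂ (fun h v => ∑ j, eval p (pderiv j h) * v j)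
    (fun h h' v => by simp [add_mul, Finset.sum_add_distrib])
    (fun a h v => by simp [smul_eval, Finset.mul_sum, mul_assoc])
    (fun h v v' => by simp [mul_add, Finset.sum_add_distrib])
    (fun a h v => by simp [Finset.mul_sum, mul_left_comm])

theorem directionalDeriv_apply (p : Fin (n + 1) → ℂ) (h : MvPolynomial (Fin (n + 1)) ℂ)
    (v : Fin (n + 1) → ℂ) : directionalDeriv p h v = ∑ j, eval p (pderiv j h) * v j := rfl

/-- A weighted sum of the derivatives of `h` at the points of `Γ`. -/
def derivSum (c : Γ → ℂ) :
    MvPolynomial (Fin (n + 1)) ℂ →ₗ[ℂ] (Γ → Fin (n + 1) → ℂ) →ₗ[ℂ] ℂ :=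
  ∑ p, c p • (LinearMap.lcomp ℂ ℂ (LinearMap.proj p)).comp (directionalDeriv p.1.rep)

theorem derivSum_apply (c : Γ → ℂ) (h : MvPolynomial (Fin (n + 1)) ℂ)
    (w : Γ → Fin (n + 1) → ℂ) :
    derivSum c h w = ∑ p, c p * directionalDeriv p.1.rep h (w p) := by
  simp [derivSum, LinearMap.sum_apply]

/-- The first order deformations `w` of `Γ`, normalized at the coordinates `j`, that remain
apolar to the functional with weights `c`. -/
def apolarDeformations (d : ℕ) (c : Γ → ℂ) (j : Γ → Fin (n + 1)) :
    Submodule ℂ (Γ → Fin (n + 1) → ℂ) where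
  carrier := {w | (∀ p, w p (j p) = 0) ∧
    ∀ h ∈ pointsIdeal Γ, h.IsHomogeneous d → derivSum c h w = 0}
  add_mem' := fun h1 h2 => ⟨fun p => by simp [h1.1 p, h2.1 p],
    fun h hh hd => by rw [map_add, h1.2 h hh hd, h2.2 h hh hd, add_zero]⟩
  zero_mem' := ⟨fun p => rfl, fun h hh hd => map_zero _⟩
  smul_mem' := fun a _ h1 => ⟨fun p => by simp [h1.1 p],
    fun h hh hd => by rw [map_smul, h1.2 h hh hd, smul_zero]⟩

instance finite_homogeneousSubmodule (d : ℕ) :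
    Module.Finite ℂ (homogeneousSubmodule (Fin (n + 1)) ℂ d) :=
  Module.Finite.iff_fg.2 (homogeneousSubmodule_fg _ _ d)

/-- Monomial coefficients determine a form. Only this upper bound matters, since it limits the
number of conditions on deformations. -/
theorem finrank_homogeneousSubmodule_le (d : ℕ) :
    Module.finrank ℂ (homogeneousSubmodule (Fin (n + 1)) ℂ d) ≤ (n + d).choose d := by
  let S := (Finset.univ : Finset (Fin (n + 1))).finsuppAntidiag d
  let ℓ : homogeneousSubmodule (Fin (n + 1)) ℂ d →ₗ[ℂ] (S → ℂ) :=
    LinearMap.pi fun α => lcoeff ℂ α.1 ∘ₗ Submodule.subtype _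
  have hℓ : Function.Injective ℓ := by
    rw [injective_iff_map_eq_zero]
    intro g hg
    apply Subtype.ext
    ext α
    by_contra hα
    have hS : α ∈ S := by
      rw [Finset.mem_finsuppAntidiag]
      refine ⟨?_, Finset.subset_univ _⟩
      have := g.2 hα
      rwa [Pi.one_def, ← Finsupp.degree_eq_weight_one, Finsupp.degree_eq_sum] at this
    exact hα (congrFun hg ⟨α, hS⟩)
  refine (LinearMap.finrank_le_finrank_of_injective hℓ).trans ?_
  rw [Module.finrank_fintype_fun_eq_card, Fintype.card_coe,
    Finset.card_finsuppAntidiag_nat_eq_choose, Finset.card_univ, Fintype.card_fin]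
  exact le_of_eq (by congr 1; omega)

theorem finrank_le_finrank_ker_prod {F T K ι : Type*} [Field F] [AddCommGroup T] [Module F T]
    [FiniteDimensional F T] [AddCommGroup K] [Module F K] [FiniteDimensional F K] [Fintype ι]
    (θ₁ : T →ₗ[F] ι → F) (θ₂ : T →ₗ[F] Module.Dual F K) : Module.finrank F T ≤
      Module.finrank F (LinearMap.ker (θ₁.prod θ₂)) + Fintype.card ι + Module.finrank F K := by
  have h1 := LinearMap.finrank_range_add_finrank_ker (θ₁.prod θ₂)
  have h3 := Submodule.finrank_le (LinearMap.range (θ₁.prod θ₂))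
  rw [Module.finrank_prod, Module.finrank_fintype_fun_eq_card, Subspace.dual_finrank_eq] at h3
  omega

/-- The conditions `θ₂` factor through the dual of `K / ⟨x⟩`, which saves one dimension in the
rank-nullity count. In the application `x` is the singular hypersurface. -/
theorem le_finrank_ker_of_apply_eq_zero {F T K ι : Type*} [Field F] [AddCommGroup T] [Module F T]
    [FiniteDimensional F T] [AddCommGroup K] [Module F K] [FiniteDimensional F K] [Fintype ι]
    (θ₁ : T →ₗ[F] ι → F) (θ₂ : T →ₗ[F] Module.Dual F K) {x : K} (hx : x ≠ 0)
    (hθ : ∀ w, θ₂ w x = 0) : Module.finrank F T + 1 ≤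
      Module.finrank F (LinearMap.ker (θ₁.prod θ₂)) + Fintype.card ι + Module.finrank F K := by
  have hx' : Submodule.span F {x} ≤ LinearMap.ker θ₂.flip := by
    rw [Submodule.span_singleton_le_iff_mem, LinearMap.mem_ker]
    ext w
    exact hθ w
  let θ : T →ₗ[F] Module.Dual F (K ⧸ Submodule.span F {x}) :=
    ((Submodule.span F {x}).liftQ θ₂.flip hx').flip
  have hker : LinearMap.ker (θ₁.prod θ) ≤ LinearMap.ker (θ₁.prod θ₂) := by
    intro w hw
    have hw1 : θ₁ w = 0 := congrArg Prod.fst (LinearMap.mem_ker.1 hw)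
    have hw2 : θ w = 0 := congrArg Prod.snd (LinearMap.mem_ker.1 hw)
    have hw3 : θ₂ w = 0 := by
      ext y
      exact LinearMap.congr_fun hw2 (Submodule.Quotient.mk y)
    exact LinearMap.mem_ker.2 (Prod.ext hw1 hw3)
  have h1 := finrank_le_finrank_ker_prod θ₁ θ
  have h2 := Submodule.finrank_mono hker
  have h3 := Submodule.finrank_quotient_add_finrank (Submodule.span F {x})
  rw [finrank_span_singleton hx] at h3
  omega

/-- Independence gives `dim I_Γ(d) = dim S_d - |Γ|`, which offsets the `|Γ|` normalizations. All
first derivatives of `g` vanish on `Γ`, so `g` imposes no condition and contributes the extra `1`.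
-/
theorem le_finrank_apolarDeformations {d : ℕ} (hind : ImposesIndependentConditions d Γ)
    (c : Γ → ℂ) (j : Γ → Fin (n + 1)) {g : MvPolynomial (Fin (n + 1)) ℂ} (hg0 : g ≠ 0)
    (hg : g.IsHomogeneous d) (hsing : IsSingularAlong g Γ) :
    Γ.card * (n + 1) + 1 ≤ Module.finrank ℂ (apolarDeformations d c j) + (n + d).choose d := by
  classical
  let S := homogeneousSubmodule (Fin (n + 1)) ℂ d
  let ev : S →ₗ[ℂ] (Γ → ℂ) :=
    LinearMap.pi fun p => (aeval p.1.rep : MvPolynomial (Fin (n + 1)) ℂ →ₐ[ℂ] ℂ).toLinearMap ∘ₗ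
      S.subtype
  have hev : ∀ g p, ev g p = eval p.1.rep g.1 := fun g p => rfl
  have hsurj : LinearMap.range ev = ⊤ := by
    refine LinearMap.range_eq_top.2 fun a => ?_
    obtain ⟨h, h1, h2⟩ := hind fun p => if hp : p ∈ Γ then a ⟨p, hp⟩ else 0
    exact ⟨⟨h, h1⟩, funext fun p => by rw [hev, h2 p.1 p.2, dif_pos p.2]⟩
  have hK := ev.finrank_range_add_finrank_ker
  rw [hsurj, finrank_top, Module.finrank_fintype_fun_eq_card, Fintype.card_coe] at hK
  let g' : LinearMap.ker ev := ⟨⟨g, hg⟩, funext fun p : Γ => (hsing p.1 p.2).1⟩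
  have hg'0 : g' ≠ 0 := fun h => hg0 (congrArg (fun x : LinearMap.ker ev => x.1.1) h)
  let θ₁ : (Γ → Fin (n + 1) → ℂ) →ₗ[ℂ] (Γ → ℂ) :=
    LinearMap.pi fun p => LinearMap.proj (j p) ∘ₗ LinearMap.proj p
  let θ₂ : (Γ → Fin (n + 1) → ℂ) →ₗ[ℂ] Module.Dual ℂ (LinearMap.ker ev) :=
    ((derivSum c).comp (S.subtype.comp (LinearMap.ker ev).subtype)).flip
  have hθ₂ : ∀ w x, θ₂ w x = derivSum c x.1.1 w := fun w x => rfl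
  have hθ : ∀ w, θ₂ w g' = 0 := by
    intro w
    rw [hθ₂, derivSum_apply, Finset.sum_eq_zero]
    intro p _
    rw [directionalDeriv_apply, Finset.sum_eq_zero, mul_zero]
    intro i _
    rw [(hsing p.1 p.2).2 i, zero_mul]
  have hker : LinearMap.ker (θ₁.prod θ₂) ≤ apolarDeformations d c j := by
    intro w hw
    have hw1 : θ₁ w = 0 := congrArg Prod.fst (LinearMap.mem_ker.1 hw)
    have hw2 : θ₂ w = 0 := congrArg Prod.snd (LinearMap.mem_ker.1 hw)
    refine ⟨fun p => congrFun hw1 p, fun h hh hhd => ?_⟩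
    have h5 : (⟨h, hhd⟩ : S) ∈ LinearMap.ker ev := by
      rw [LinearMap.mem_ker]
      funext p
      rw [hev]
      exact hh _ (rep_mem_cone p.2)
    rw [← hθ₂ w ⟨⟨h, hhd⟩, h5⟩, hw2]
    rfl
  have h1 := le_finrank_ker_of_apply_eq_zero (K := LinearMap.ker ev) θ₁ θ₂ (x := g')
    (fun h => hg'0 h) hθ
  have h2 := Submodule.finrank_mono hker
  rw [Module.finrank_pi_fintype] at h1
  simp only [Module.finrank_fintype_fun_eq_card, Fintype.card_fin, Finset.sum_const,
    Finset.card_univ, Fintype.card_coe, smul_eq_mul] at h1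
  have h4 : Module.finrank ℂ S ≤ _ := finrank_homogeneousSubmodule_le (n := n) d
  omega

/-- A deformation that is normalized at the coordinates `j` and tangent to all hypersurfaces
through `Γ` of degree `1 + |Γ|` is zero. -/
theorem eq_zero_of_directionalDeriv_eq_zero {j : Γ → Fin (n + 1)}
    (hj : ∀ p : Γ, p.1.rep (j p) ≠ 0) {w : Γ → Fin (n + 1) → ℂ} (hwj : ∀ p, w p (j p) = 0)
    (hw : ∀ h ∈ pointsIdeal Γ, h.IsHomogeneous (1 + Γ.card) →
      ∀ p : Γ, directionalDeriv p.1.rep h (w p) = 0) : w = 0 := by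
  classical
  funext p i
  by_contra hi
  change w p i ≠ 0 at hi
  obtain ⟨q, hq, hq1, hq0⟩ := exists_interpolation Γ le_rfl p.1
  -- The linear form `a` vanishes at `p`, and `q` is `1` at `p` and `0` at the other points. So `a *
  -- q` passes through `Γ`, and its derivative at `p` along `w p` is `p_j w_i - p_i w_j`, which the
  -- normalization `w_j = 0` reduces to `p_j w_i`.
  let a : MvPolynomial (Fin (n + 1)) ℂ :=
    C (p.1.rep (j p)) * X i - C (p.1.rep i) * X (j p)
  have ha : a.IsHomogeneous 1 :=
    ((isHomogeneous_X ℂ i).C_mul _).sub ((isHomogeneous_X ℂ (j p)).C_mul _)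
  have hap : eval p.1.rep a = 0 := by simp [a, mul_comm]
  have hhom : (a * q).IsHomogeneous (1 + Γ.card) := ha.mul hq
  have h1 := hw (a * q) ((mem_pointsIdeal_iff_of_isHomogeneous hhom).2 fun r hr => by
    by_cases hrp : r = p.1
    · rw [hrp, map_mul, hap, zero_mul]
    · rw [map_mul, hq0 r hr hrp, mul_zero]) hhom p
  rw [directionalDeriv_apply] at h1
  have h2 : ∀ l, eval p.1.rep (pderiv l (a * q)) =
      p.1.rep (j p) * (Pi.single (M := fun _ => ℂ) l 1 i) -
        p.1.rep i * (Pi.single (M := fun _ => ℂ) l 1 (j p)) := by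
    intro l
    rw [Derivation.leibniz, map_add, smul_eq_mul, smul_eq_mul, map_mul, map_mul, hap, hq1, zero_mul,
      zero_add, one_mul]
    simp only [a, map_sub, Derivation.leibniz, pderiv_C, pderiv_X, smul_eq_mul, mul_zero, add_zero,
      map_mul, eval_C]
    congr 2 <;> · simp only [Pi.single_apply]; split_ifs <;> simp
  simp only [h2, sub_mul, Finset.sum_sub_distrib, Pi.single_apply, mul_ite, ite_mul, mul_one,
    mul_zero, zero_mul, Finset.sum_ite_eq, Finset.mem_univ, if_true, hwj, sub_zero] at h1
  exact mul_ne_zero (hj p) hi h1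

end Tangent

/-! ### Derivations of the trivial square zero extension -/

/-- A linear form on `V`, as a derivation of the trivial square zero extension by `V`. -/
def sndForm {V : Type} [AddCommGroup V] [Module ℂ V] (Λ : Module.Dual ℂ V) :
    TrivSqZeroExt ℂ V →+ ℂ where
  toFun r := Λ r.snd
  map_zero' := by simp
  map_add' a b := by simp

section TrivSqZeroExt

variable {V : Type} [AddCommGroup V] [Module ℂ V] (Λ : Module.Dual ℂ V)

theorem sndForm_mul [Module ℂᵐᵒᵖ V] [IsCentralScalar ℂ V] (a b : TrivSqZeroExt ℂ V) :
    sndForm Λ (a * b) = a.fst * sndForm Λ b + b.fst * sndForm Λ a := by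
  simp [sndForm]

theorem sndForm_inl_add_inr (a : ℂ) (v : V) :
    sndForm Λ (TrivSqZeroExt.inl a + TrivSqZeroExt.inr v) = Λ v := by
  simp [sndForm]

theorem sndForm_inl (a : ℂ) : sndForm Λ (TrivSqZeroExt.inl a) = 0 := by
  simp [sndForm]

instance isLocalRing_trivSqZeroExt [Module ℂᵐᵒᵖ V] [IsCentralScalar ℂ V] :
    IsLocalRing (TrivSqZeroExt ℂ V) :=
  have : IsLocalHom (TrivSqZeroExt.fstHom ℂ ℂ V).toRingHom :=
    ⟨fun _ ha => TrivSqZeroExt.isUnit_iff_isUnit_fst.2 ha⟩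
  RingHom.domain_isLocalRing (TrivSqZeroExt.fstHom ℂ ℂ V).toRingHom

end TrivSqZeroExt

/-! ### Embedding dimension and first order deformations -/

/-- On the maximal ideal the second component of `ψ` is linear over the residue field, because `V`
squares to zero. Hence a functional killing the images of generators kills the image of the maximal
ideal, and then that of all of `B`; by `hV` these images span `V`. -/
theorem finrank_le_spanFinrank_maximalIdeal {B V : Type} [CommRing B] [IsLocalRing B]
    [IsNoetherianRing B] [AddCommGroup V] [Module ℂ V] [Module ℂᵐᵒᵖ V] [IsCentralScalar ℂ V]
    [FiniteDimensional ℂ V] (ι : ℂ →+* B) (ψ : B →+* TrivSqZeroExt ℂ V)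
    (hψ : ∀ a, ψ (ι a) = TrivSqZeroExt.inl a)
    (hV : ∀ Λ : Module.Dual ℂ V, (∀ b, Λ (ψ b).snd = 0) → Λ = 0) :
    Module.finrank ℂ V ≤ (IsLocalRing.maximalIdeal B).spanFinrank := by
  have hρ : Function.Surjective ((TrivSqZeroExt.fstHom ℂ ℂ V).toRingHom.comp ψ) := fun a =>
    ⟨ι a, by simp [hψ]⟩
  have hfst : ∀ b, (ψ b).fst = 0 ↔ b ∈ IsLocalRing.maximalIdeal B := by
    intro b
    rw [← ker_eq_maximalIdeal hρ]
    rfl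
  have hfg : (IsLocalRing.maximalIdeal B).FG := IsNoetherian.noetherian _
  let s := (IsLocalRing.maximalIdeal B).generators
  have hs : s.Finite := Submodule.FG.finite_generators hfg
  have hspan : Submodule.span ℂ ((fun b => (ψ b).snd) '' s) = ⊤ := by
    by_contra hne
    obtain ⟨Λ, hΛ0, hΛ⟩ := Submodule.exists_le_ker_of_lt_top _ (lt_top_iff_ne_top.2 hne)
    refine hΛ0 (hV Λ fun b => ?_)
    have hm : ∀ b ∈ IsLocalRing.maximalIdeal B, Λ (ψ b).snd = 0 := by
      intro b hb
      rw [← Submodule.span_generators (IsLocalRing.maximalIdeal B)] at hb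
      have hsm : ∀ x ∈ s, x ∈ IsLocalRing.maximalIdeal B := fun x hx => by
        rw [← Submodule.span_generators (IsLocalRing.maximalIdeal B)]
        exact Submodule.subset_span hx
      induction hb using Submodule.span_induction with
      | mem x hx => exact hΛ (Submodule.subset_span ⟨x, hx, rfl⟩)
      | zero => simp
      | add x y _ _ hx hy => rw [map_add, TrivSqZeroExt.snd_add, map_add, hx, hy, add_zero]
      | smul a x hx hx0 =>
        rw [Submodule.span_generators] at hx
        rw [smul_eq_mul, map_mul, TrivSqZeroExt.snd_mul, (hfst x).2 hx]
        simp [hx0]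
    -- Subtracting the constant `ι (ψ b).fst` leaves the second component unchanged, as `ψ ∘ ι` has
    -- none.
    have hb : b - ι (ψ b).fst ∈ IsLocalRing.maximalIdeal B := by
      rw [← hfst]
      simp [hψ]
    have := hm _ hb
    simpa [hψ] using this
  have hsfin : ((fun b => (ψ b).snd) '' s).Finite := hs.image _
  have : Fintype ((fun b => (ψ b).snd) '' s) := hsfin.fintype
  have h1 := finrank_span_le_card (R := ℂ) ((fun b => (ψ b).snd) '' s)
  rw [hspan, finrank_top] at h1
  refine h1.trans ?_
  rw [← Set.ncard_eq_toFinset_card', ← Submodule.FG.generators_ncard hfg]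
  exact Set.ncard_image_le hs

/-! ### Singularities of varieties of power sums -/

namespace HilbertScheme

variable (H : HilbertScheme n k)

/-- If the apolar subscheme passes through `[Γ]`, then `f` is apolar to all forms through `Γ`. -/
theorem apolarForm_eq_zero {d : ℕ} {f : MvPolynomial (Fin (n + 1)) ℂ}
    {Γ : Finset (ℙ ℂ (Fin (n + 1) → ℂ))} (hΓ : Γ.card = k)
    (hind : ImposesIndependentConditions d Γ) (hJ : H.apolarIdeal d f (H.point Γ hΓ) ≠ ⊤)
    {h : MvPolynomial (Fin (n + 1)) ℂ} (hh : h ∈ pointsIdeal Γ) (hhd : h.IsHomogeneous d) :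
    apolarForm f h = 0 := by
  obtain ⟨ρ, hρ1, hρ2⟩ := H.exists_stalk_hom hΓ (ι := RingHom.id ℂ) (ρ := RingHom.id ℂ) rfl
    (P := fun p => p.1.rep) fun p j => rfl
  have hρ : Function.Surjective ρ := fun z => ⟨_, RingHom.congr_fun hρ1 z⟩
  have hle : ∀ g ∈ (H.family (H.scheme.fromSpecStalk (H.point Γ hΓ))).ideal,
      map ρ g ∈ pointsIdeal Γ := by
    intro g hg
    have := map_mem_pointsIdeal_of_mem_sectionsIdeal (ρ := RingHom.id ℂ) (fun p j => rfl)
      (hρ2 g hg)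
    rwa [map_id] at this
  obtain ⟨g, hg, hgd, rfl⟩ := PointFamily.exists_lift hρ hΓ hle hind hh hhd
  have h1 : apolarPairing (H.stalkMap (H.point Γ hΓ)) f g ∈ RingHom.ker ρ := by
    rw [ker_eq_maximalIdeal hρ]
    -- A proper ideal of a local ring reduces to zero in the residue field, so the equation given by
    -- the lift of `h` holds at `[Γ]`.
    exact IsLocalRing.le_maximalIdeal hJ (Ideal.subset_span ⟨g, hg, hgd, rfl⟩)
  rw [RingHom.mem_ker, map_apolarPairing, hρ1] at h1
  exact h1

/-- All deformations are treated at once, over `ℂ ⊕ W^*` instead of one copy of the dual numbers for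
each `w`. Evaluation at `w` recovers the individual tangent vector. -/
theorem finrank_apolarDeformations_le {d : ℕ} {f : MvPolynomial (Fin (n + 1)) ℂ}
    {Γ : Finset (ℙ ℂ (Fin (n + 1) → ℂ))} (hΓ : Γ.card = k)
    [IsLocalRing (H.VSPLocalRing d f (H.point Γ hΓ))]
    [IsNoetherianRing (H.VSPLocalRing d f (H.point Γ hΓ))] {c : Γ → ℂ}
    (hc : ∀ h : MvPolynomial (Fin (n + 1)) ℂ, h.IsHomogeneous d →
      apolarForm f h = ∑ p, c p * eval p.1.rep h) {j : Γ → Fin (n + 1)}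
    (hj : ∀ p : Γ, p.1.rep (j p) ≠ 0) :
    Module.finrank ℂ (apolarDeformations d c j) ≤
      (IsLocalRing.maximalIdeal (H.VSPLocalRing d f (H.point Γ hΓ))).spanFinrank := by
  let W := apolarDeformations d c j
  let V := Module.Dual ℂ W
  let R := TrivSqZeroExt ℂ V
  let ρ : R →+* ℂ := (TrivSqZeroExt.fstHom ℂ ℂ V).toRingHom
  let ι : ℂ →+* R := TrivSqZeroExt.inlHom ℂ V
  -- The tautological deformation: its infinitesimal part is the coordinate functional `w ↦ w p i`.
  let coord : Γ → Fin (n + 1) → V := fun p i =>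
    LinearMap.proj i ∘ₗ LinearMap.proj p ∘ₗ W.subtype
  let P : Γ → Fin (n + 1) → R := fun p i =>
    TrivSqZeroExt.inl (p.1.rep i) + TrivSqZeroExt.inr (coord p i)
  have hP : ∀ p i, ρ (P p i) = p.1.rep i := fun p i =>
    add_zero _
  -- the derivation in the direction `w`
  let D : W → R →+ ℂ := fun w => sndForm (Module.Dual.eval ℂ W w)
  have hD : ∀ w a b, D w (a * b) = ρ a * D w b + ρ b * D w a := fun w a b => sndForm_mul _ a b
  have hDι : ∀ w a, D w (ι a) = 0 := fun w a => sndForm_inl _ a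
  have hDP : ∀ w p i, D w (P p i) = w.1 p i := fun w p i => sndForm_inl_add_inr _ _ _
  obtain ⟨ψ, hψι, hψ⟩ := H.exists_stalk_hom hΓ (ι := ι) (ρ := ρ) rfl hP
  have hρψ : Function.Surjective (ρ.comp ψ) := fun z =>
    ⟨H.stalkMap _ z, congrArg ρ (RingHom.congr_fun hψι z)⟩
  have hle : ∀ g ∈ (H.family (H.scheme.fromSpecStalk (H.point Γ hΓ))).ideal,
      map (ρ.comp ψ) g ∈ pointsIdeal Γ := by
    intro g hg
    have := map_mem_pointsIdeal_of_mem_sectionsIdeal hP (hψ g hg)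
    rwa [map_map] at this
  -- the first order expansion of the equations of the universal family
  have hexp : ∀ g ∈ (H.family (H.scheme.fromSpecStalk (H.point Γ hΓ))).ideal, ∀ e,
      g.IsHomogeneous e → ∀ w p, eval p.1.rep (coeffMap (D w) (map ψ g)) +
        directionalDeriv p.1.rep (map (ρ.comp ψ) g) (w.1 p) = 0 := by
    intro g hg e hge w p
    have h1 := (mem_sectionsIdeal_iff_of_isHomogeneous (hge.map ψ)).1 (hψ g hg) p
    have h2 := derivation_eval (D w) ρ (hD w) (P p) (map ψ g)
    rw [h1, map_zero] at h2
    simp only [hP, hDP, map_map] at h2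
    exact h2.symm
  have hker : ∀ a ∈ H.apolarIdeal d f (H.point Γ hΓ), ψ a = 0 := by
    refine fun a ha => (RingHom.mem_ker).1 (Ideal.span_le.2 ?_ ha)
    rintro _ ⟨g, hg, hgd, rfl⟩
    rw [SetLike.mem_coe, RingHom.mem_ker]
    refine TrivSqZeroExt.ext ?_ ?_
    · change ρ (ψ _) = 0
      rw [← RingHom.comp_apply, map_apolarPairing, RingHom.comp_assoc, hψι]
      change apolarForm f (map (ρ.comp ψ) g) = 0
      rw [hc _ (hgd.map _)]
      exact Finset.sum_eq_zero fun p _ => by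
        rw [show eval p.1.rep (map (ρ.comp ψ) g) = 0 from hle g hg _ (rep_mem_cone p.2), mul_zero]
    · refine LinearMap.ext fun w => ?_
      change D w (ψ _) = 0
      rw [map_apolarPairing, hψι, derivation_apolarPairing ι f (D w)
        (fun a b => by rw [hD, hDι, mul_zero, add_zero]; rfl),
        hc _ (isHomogeneous_coeffMap _ (hgd.map ψ))]
      -- The weighted sum of the expansions `hexp` trades the change of the coefficients of `g` for
      -- its derivatives along `w`, whose weighted sum vanishes by the definition of `W`.
      have h3 := w.2.2 _ (hle g hg) (hgd.map _)
      rw [derivSum_apply] at h3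
      rw [← add_zero (∑ p : Γ, _), ← h3, ← Finset.sum_add_distrib]
      refine (Finset.sum_eq_zero fun p _ => ?_).trans h3.symm
      rw [← mul_add, hexp g hg d hgd, mul_zero]
  let ψ' : H.VSPLocalRing d f (H.point Γ hΓ) →+* R :=
    Ideal.Quotient.lift (H.apolarIdeal d f (H.point Γ hΓ)) ψ hker
  have hψ' : ∀ a, ψ' (Ideal.Quotient.mk _ a) = ψ a := fun a => rfl
  have hV : ∀ Λ : Module.Dual ℂ V, (∀ b, Λ (ψ' b).snd = 0) → Λ = 0 := by
    intro Λ hΛ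
    -- Finite-dimensional duality makes `Λ` evaluation at some `w`. If it kills the image, the
    -- equations of the family do not change along `w`, so `w` is tangent to every form of degree `1
    -- + |Γ|` through `Γ`.
    obtain ⟨w, rfl⟩ := (Module.evalEquiv ℂ W).surjective Λ
    have hw : ∀ a, D w (ψ a) = 0 := fun a => hΛ (Ideal.Quotient.mk _ a)
    suffices h : w.1 = 0 by
      rw [show w = 0 from Subtype.ext h, map_zero]
    refine eq_zero_of_directionalDeriv_eq_zero hj w.2.1 fun h hh hhe p => ?_
    obtain ⟨g, hg, hge, rfl⟩ := PointFamily.exists_lift hρψ hΓ hle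
      (imposesIndependentConditions_of_card_le (by omega)) hh hhe
    have h1 := hexp g hg _ hge w p
    have h2 : coeffMap (D w) (map ψ g) = 0 := by
      ext α
      rw [coeff_coeffMap, coeff_map, hw, coeff_zero]
    rwa [h2, map_zero, zero_add] at h1
  have hfin := finrank_le_spanFinrank_maximalIdeal
    ((Ideal.Quotient.mk _).comp (H.stalkMap (H.point Γ hΓ))) ψ'
    (fun a => RingHom.congr_fun hψι a) hV
  rwa [Subspace.dual_finrank_eq] at hfin

/-- `VSP(F, k)` is singular at `[Γ]` if a hypersurface of degree `d` is singular along `Γ`. The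
expected dimension makes the local ring nonzero, so that `[Γ]` is a point of the apolar subscheme
and `f` is a power sum supported on `Γ`. -/
theorem isSingularAt_point {d : ℕ} {f : MvPolynomial (Fin (n + 1)) ℂ}
    {Γ : Finset (ℙ ℂ (Fin (n + 1) → ℂ))} (hΓ : Γ.card = k)
    (hdim : H.HasExpectedDimensionAt d f (H.point Γ hΓ))
    (hind : ImposesIndependentConditions d Γ) {g : MvPolynomial (Fin (n + 1)) ℂ} (hg0 : g ≠ 0)
    (hgd : g.IsHomogeneous d) (hg : IsSingularAlong g Γ) :
    H.IsSingularAt d f (H.point Γ hΓ) := by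
  intro hreg
  have hJ : H.apolarIdeal d f (H.point Γ hΓ) ≠ ⊤ :=
    -- The regular local ring assumed for contradiction is nonzero, so `[Γ]` lies on the apolar
    -- subscheme.
    Ideal.Quotient.nontrivial_iff.1 hreg.toIsLocalRing.toNontrivial
  obtain ⟨c, hc⟩ := exists_apolarForm_eq f hind fun h hh hhd =>
    H.apolarForm_eq_zero hΓ hind hJ hh hhd
  choose j hj using fun p : Γ => Function.ne_iff.1 p.1.rep_nonzero
  have h1 := H.finrank_apolarDeformations_le hΓ hc hj
  have h2 := le_finrank_apolarDeformations hind c j hg0 hgd hg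
  have h3 := hdim
  -- Regularity equates Krull and embedding dimension, while `h1` and `h2` force the latter to be at
  -- least one larger than expected.
  rw [HasExpectedDimensionAt, ← hreg.spanFinrank_maximalIdeal] at h3
  have h4 : (IsLocalRing.maximalIdeal (H.VSPLocalRing d f (H.point Γ hΓ))).spanFinrank +
      (n + d).choose d = k * (n + 1) := by exact_mod_cast h3
  rw [hΓ] at h2
  omega

end HilbertScheme

end PowerSum

theorem mainTheorem9 (n d k : ℕ) (H : PowerSum.HilbertScheme n k)
    (f : MvPolynomial (Fin (n + 1)) ℂ) (hf0 : f ≠ 0) (hf : f.IsHomogeneous d)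
    (Γ : Finset (ℙ ℂ (Fin (n + 1) → ℂ))) (hΓ : Γ.card = k)
    (hmem : H.point Γ hΓ ∈ H.vsp d f)
    (hdim : H.HasExpectedDimensionAt d f (H.point Γ hΓ))
    (hind : PowerSum.ImposesIndependentConditions d Γ)
    (hsing : ∃ g : MvPolynomial (Fin (n + 1)) ℂ,
      g ≠ 0 ∧ g.IsHomogeneous d ∧ PowerSum.IsSingularAlong g Γ) :
    H.IsSingularAt d f (H.point Γ hΓ) := by
  obtain ⟨g, hg0, hgd, hg⟩ := hsing
  exact H.isSingularAt_point hΓ hdim hind hg0 hgd hg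

end
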